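/- **Setting.** Let $N\ge 3f+1$. There are $N$ nodes, of which at most $f$ are Byzantine; the others are correct. The network is asynchronous with authenticated channels: messages between correct nodes can be delayed arbitrarily but are not lost, a message is accepted as coming from a correct node only if that node sent it to the receiver, Byzantine nodes send arbitrary messages, and a correct node does not postpone forever a local action that stays enabled. The hash function of the Merkle trees is arbitrary; executions are considered in which no two distinct inputs that correct nodes hash for the same dispersal instance have the same digest. (The inputs counted are those in the Merkle trees of a block dispersed by a correct proposer and of blocks successfully retrieved by correct nodes, and in the Merkle proofs of chunks accepted by correct nodes during retrieval.) **Binary agreement (BA).** A BA instance takes at most one input bit from, and gives at most one output bit to, each correct node, such that: if all correct nodes give an input, then every correct node eventually gets an output (Termination); if a correct node gets output $b$, then every correct node eventually gets output $b$ (Agreement); if a correct node gets output $b$, then some correct node has already given input $b$ (Validity). **Verifiable information dispersal (AVID-M).** An $(N-2f,N)$-erasure code encodes a block into $N$ chunks, any $N-2f$ of which decode to it. To disperse a block, the proposer computes the Merkle root $r$ of its $N$ chunks and sends to each node $i$ the root, the $i$-th chunk and its Merkle proof. In the instances reserved for node $j$, chunks are accepted only from node $j$. On the first chunk with a valid proof,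 a node stores it with its root and proof and broadcasts $\mathtt{GotChunk}(r)$. On receiving $N-f$ $\mathtt{GotChunk}(r)$ or $f+1$ $\mathtt{Ready}(r)$ from different nodes it broadcasts $\mathtt{Ready}(r)$; on receiving $2f+1$ $\mathtt{Ready}(r)$ it completes the instance with agreed root $r$. Only the first $\mathtt{GotChunk}$ and the first $\mathtt{Ready}$ of each sender count. To retrieve a block, a node asks all nodes for their chunks; a node returns its chunk, root and proof once it has completed the instance, if its stored root is the agreed one. From any $N-2f$ valid returned chunks with a common root $r$ the retrieving node decodes a block $B'$, and the result is $B'$ if the Merkle root of the encoding of $B'$ is $r$, and an error string otherwise. **DispersedLedger with inter-node linking.** Each epoch $e=1,2,\dots$ has for each node $j$ a dispersal instance $\mathrm{VID}^e_j$ and a BA instance $\mathrm{BA}^e_j$. A correct node $i$ starts epoch $e$ when all its BA instances of epoch $e-1$ have an output (epoch 1: at once). It then lets $V[j]$, for each $j$, be the largest $t$ such that $\mathrm{VID}^1_j,\dots,\mathrm{VID}^t_j$ are complete at it, and disperses in $\mathrm{VID}^e_i$ a block consisting of transactions and of $V$. It inputs $1$ to $\mathrm{BA}^e_j$ when $\mathrm{VID}^e_j$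 completes, unless it has already given an input; when $N-f$ BA instances of epoch $e$ have output $1$, it inputs $0$ to those to which it has given no input. When all BA instances of epoch $e$ have an output, let $S^e$ be the set of $j$ with output $1$ of $\mathrm{BA}^e_j$. The node retrieves the blocks of $\mathrm{VID}^e_j$, $j\in S^e$, and delivers them sorted by $j$. Let $E^e[j]$ be the $(f+1)$-th largest, with multiplicity, of the values $V_k[j]$, $k\in S^e$, where $V_k$ is the array in the block retrieved from $\mathrm{VID}^e_k$, taken as $(\infty,\dots,\infty)$ if the retrieval returned the error string or the block is ill-formatted. The node then retrieves all blocks of $\mathrm{VID}^d_j$ with $1\le d\le E^e[j]$ that it has not yet delivered, and delivers them sorted first by $d$ and then by $j$. Retrievals may run in parallel with other epochs, but epochs are delivered in order; each instance is retrieved at most once by a node. A block in $S^e$ that was already delivered through linking in an earlier epoch is either always skipped or always delivered again; the theorem covers both variants. **Theorem (Agreement and Total Order).** In every such execution, any two correct nodes $i$ and $j$ deliver the same sequence of blocks. That is, where a delivered block is identified by its epoch, its proposer and the retrieved content: for every $n$, a block is the $n$-th block that $i$ ever delivers if and only if it is the $n$-th block that $j$ ever delivers; at any two times, one of the sequences delivered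 so far by $i$ and by $j$ is a prefix of the other; and for every $e\ge 0$, both nodes eventually finish the delivery of their first $e$ epochs, and the sequences they have delivered in these epochs are equal. -/

import Mathlib

namespace DispersedLedger

noncomputable section

/-! ## Merkle trees and erasure codes -/

/-- The inputs of the hash function in a Merkle tree: a leaf (a chunk, or `none` for the padding that
fills the tree up to a power of two), or a pair of child digests. -/
inductive HashInput (Chunk Digest : Type*) where
  | leaf (c : Option Chunk)
  | node (l r : Digest)

section Merkle

variable {Chunk Digest : Type*} (hash : HashInput Chunk Digest → Digest)

/-- Root of the complete binary Merkle tree of depth `d` with leaves `C 0, …, C (2 ^ d - 1)`. -/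
def merkleRoot : ℕ → (ℕ → Option Chunk) → Digest
  | 0, C => hash (.leaf (C 0))
  | d + 1, C => hash (.node (merkleRoot d C) (merkleRoot d (fun n => C (n + 2 ^ d))))

/-- All inputs that are hashed when the root of this tree is computed. -/
def merkleInputs : ℕ → (ℕ → Option Chunk) → Set (HashInput Chunk Digest)
  | 0, C => {.leaf (C 0)}
  | d + 1, C =>
      {.node (merkleRoot hash d C) (merkleRoot hash d (fun n => C (n + 2 ^ d)))} ∪
        merkleInputs d C ∪ merkleInputs d (fun n => C (n + 2 ^ d))

/-- Merkle proof of the `n`-th leaf: the digests of the siblings on the way from the root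
to that leaf, topmost first. -/
def merkleProof : ℕ → (ℕ → Option Chunk) → ℕ → List Digest
  | 0, _, _ => []
  | d + 1, C, n =>
      if n < 2 ^ d then
        merkleRoot hash d (fun m => C (m + 2 ^ d)) :: merkleProof d C n
      else
        merkleRoot hash d C :: merkleProof d (fun m => C (m + 2 ^ d)) (n - 2 ^ d)

/-- The root recomputed from a chunk `c`, its claimed position `n` and a list of siblings. -/
def pathRoot : List Digest → ℕ → Chunk → Digest
  | [], _, c => hash (.leaf (some c))
  | y :: π, n, c =>
      if n < 2 ^ π.length then hash (.node (pathRoot π n c) y)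
      else hash (.node y (pathRoot π (n - 2 ^ π.length) c))

/-- All inputs that are hashed in this computation. -/
def pathInputs : List Digest → ℕ → Chunk → Set (HashInput Chunk Digest)
  | [], _, c => {.leaf (some c)}
  | y :: π, n, c =>
      if n < 2 ^ π.length then
        {.node (pathRoot hash π n c) y} ∪ pathInputs π n c
      else
        {.node y (pathRoot hash π (n - 2 ^ π.length) c)} ∪ pathInputs π (n - 2 ^ π.length) c

end Merkle

/-- A `(k, n)`-erasure code: a block is encoded into `n` chunks, any `k` of which decode to it.
On chunks that do not come from an encoding, `decode` may return any block. -/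
structure ErasureCode (k n : ℕ) (Raw Chunk : Type*) where
  encode : Raw → Fin n → Chunk
  decode : (Fin n → Option Chunk) → Raw
  decode_encode : ∀ (B : Raw) (D : Finset (Fin n)), D.card = k →
    decode (fun m => if m ∈ D then some (encode B m) else none) = B

/-! ## Protocol parameters -/

/-- The public parameters of the protocol: erasure code, hash function and block format. A well-formed
block consists of transactions and an observation array; `unpack` returns `none` on an ill-formatted
block. `skipDelivered` tells whether a block that is committed by binary agreement after it
was already delivered through inter-node linking is skipped or delivered again. -/
structure Protocol (N f : ℕ) (Tx Raw Chunk Digest : Type*) where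
  code : ErasureCode (N - 2 * f) N Raw Chunk
  hash : HashInput Chunk Digest → Digest
  pack : Tx × (Fin N → ℕ) → Raw
  unpack : Raw → Option (Tx × (Fin N → ℕ))
  unpack_pack : ∀ b, unpack (pack b) = some b
  skipDelivered : Bool

section

variable {N f : ℕ} {Tx Raw Chunk Digest : Type*}

namespace Protocol

variable (P : Protocol N f Tx Raw Chunk Digest)

/-- The encoding of a block, padded to an infinite array of leaves. -/
def leaves (B : Raw) (n : ℕ) : Option Chunk :=
  if h : n < N then some (P.code.encode B ⟨n, h⟩) else none

/-- The Merkle root of the encoding of a block. -/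
def root (B : Raw) : Digest := merkleRoot P.hash (Nat.clog 2 N) (P.leaves B)

/-- The Merkle proof of the `m`-th chunk of the encoding of a block. -/
def proof (B : Raw) (m : Fin N) : List Digest :=
  merkleProof P.hash (Nat.clog 2 N) (P.leaves B) m

/-- `π` is a valid proof that `c` is the `m`-th chunk under root `r`. -/
def Verify (r : Digest) (m : Fin N) (c : Chunk) (π : List Digest) : Prop :=
  π.length = Nat.clog 2 N ∧ pathRoot P.hash π m c = r

end Protocol

/-! ## Messages and local states -/

/-- An instance of information dispersal or binary agreement: epoch (starting from 1) and node. -/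
abbrev Inst (N : ℕ) := ℕ × Fin N

inductive Msg (N : ℕ) (Chunk Digest : Type*) where
  | chunk (x : Inst N) (r : Digest) (c : Chunk) (π : List Digest)
  | gotChunk (x : Inst N) (r : Digest)
  | ready (x : Inst N) (r : Digest)
  | requestChunk (x : Inst N)
  | returnChunk (x : Inst N) (r : Digest) (c : Chunk) (π : List Digest)

/-- A delivered block: its instance and the result of retrieving it, `none` being the error
string that is returned when the check of the re-encoding fails. -/
abbrev Entry (N : ℕ) (Raw : Type*) := Inst N × Option Raw

/-- Local state of a correct node. -/
structure NodeState (N : ℕ) (Raw Chunk Digest : Type*) where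
  /-- dispersal server: root, chunk and proof received from the proposer -/
  myChunk : Inst N → Option (Digest × Chunk × List Digest)
  /-- dispersal server: root in the first `gotChunk` message of each sender -/
  gotFrom : Inst N → Fin N → Option Digest
  /-- dispersal server: root in the first `ready` message of each sender -/
  readyFrom : Inst N → Fin N → Option Digest
  /-- dispersal server: the agreed root; it is set exactly if the dispersal is complete -/
  chunkRoot : Inst N → Option Digest
  /-- retrieval server: clients that have requested our chunk -/
  asked : Inst N → Set (Fin N)
  /-- retrieval server: clients to which our chunk was returned -/
  answered : Inst N → Set (Fin N)
  /-- retrieval client: instances on which retrieval was invoked -/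
  requested : Set (Inst N)
  /-- retrieval client: first valid root, chunk and proof returned by each server -/
  gathered : Inst N → Fin N → Option (Digest × Chunk × List Digest)
  /-- retrieval client: result of a finished retrieval -/
  retrieved : Inst N → Option (Option Raw)
  /-- own input to each binary agreement instance -/
  baIn : Inst N → Option Bool
  /-- output of each binary agreement instance -/
  baOut : Inst N → Option Bool
  /-- the latest epoch whose dispersal phase was started; `0` initially -/
  epoch : ℕ
  /-- the block proposed in each epoch -/
  proposal : ℕ → Option Raw
  /-- the number of epochs whose retrieval phase is finished -/
  finished : ℕ
  /-- whether the blocks committed by binary agreement in epoch `finished + 1` are delivered -/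
  linking : Bool
  /-- instances marked as delivered -/
  delivered : Set (Inst N)
  /-- the sequence of blocks delivered so far -/
  log : List (Entry N Raw)

def initialState (N : ℕ) (Raw Chunk Digest : Type*) : NodeState N Raw Chunk Digest where
  myChunk := fun _ => none
  gotFrom := fun _ _ => none
  readyFrom := fun _ _ => none
  chunkRoot := fun _ => none
  asked := fun _ => ∅
  answered := fun _ => ∅
  requested := ∅
  gathered := fun _ _ => none
  retrieved := fun _ => none
  baIn := fun _ => none
  baOut := fun _ => none
  epoch := 0
  proposal := fun _ => none
  finished := 0
  linking := false
  delivered := ∅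
  log := []

/-- Outgoing messages of a node, with their receivers. -/
abbrev Outbox (N : ℕ) (Chunk Digest : Type*) := Set (Fin N × Msg N Chunk Digest)

def broadcast (m : Msg N Chunk Digest) : Outbox N Chunk Digest := {q | q.2 = m}

/-- The number of senders whose message carried root `r`. -/
def rootCount (v : Fin N → Option Digest) (r : Digest) : ℕ := {k | v k = some r}.ncard

/-! ## Message handlers -/

open Classical in
/-- Reaction of node `i` in state `s` to a message from node `k`. Chunks for the instances of node
`j` are only accepted from node `j`; further messages of one kind from one sender are ignored. -/
def handle (P : Protocol N f Tx Raw Chunk Digest) (i k : Fin N)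
    (s : NodeState N Raw Chunk Digest) :
    Msg N Chunk Digest → NodeState N Raw Chunk Digest × Outbox N Chunk Digest
  | .chunk x r c π =>
      if k = x.2 ∧ s.myChunk x = none ∧ P.Verify r i c π then
        ({ s with myChunk := Function.update s.myChunk x (some (r, c, π)) },
          broadcast (.gotChunk x r))
      else (s, ∅)
  | .gotChunk x r =>
      if s.gotFrom x k = none then
        let v := Function.update (s.gotFrom x) k (some r)
        ({ s with gotFrom := Function.update s.gotFrom x v },
          if N - f ≤ rootCount v r then broadcast (.ready x r) else ∅)
      else (s, ∅)
  | .ready x r =>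
      if s.readyFrom x k = none then
        let v := Function.update (s.readyFrom x) k (some r)
        ({ s with
            readyFrom := Function.update s.readyFrom x v
            chunkRoot := if 2 * f + 1 ≤ rootCount v r then
              Function.update s.chunkRoot x (some r) else s.chunkRoot },
          if f + 1 ≤ rootCount v r then broadcast (.ready x r) else ∅)
      else (s, ∅)
  | .requestChunk x =>
      ({ s with asked := Function.update s.asked x (s.asked x ∪ {k}) }, ∅)
  | .returnChunk x r c π =>
      if x ∈ s.requested ∧ s.gathered x k = none ∧ P.Verify r k c π then
        let v := Function.update (s.gathered x) k (some (r, c, π))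
        ({ s with gathered := Function.update s.gathered x v }, ∅)
      else (s, ∅)

/-! ## Local computations -/

namespace NodeState

variable (s : NodeState N Raw Chunk Digest)

/-- The dispersal of instance `x` has completed at this node. -/
def Complete (x : Inst N) : Prop := s.chunkRoot x ≠ none

/-- Epoch `e` was started, and all its binary agreement instances have an output. -/
def Decided (e : ℕ) : Prop := 1 ≤ e ∧ e ≤ s.epoch ∧ ∀ j, s.baOut (e, j) ≠ none

/-- The indices of the binary agreement instances of epoch `e` with output `1`. -/
def committed (e : ℕ) : Finset (Fin N) := Finset.univ.filter (fun j => s.baOut (e, j) = some true)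

/-- All blocks committed by binary agreement in epoch `e` are retrieved. -/
def Downloaded (e : ℕ) : Prop :=
  s.Decided e ∧ ∀ j ∈ s.committed e, s.retrieved (e, j) ≠ none

/-- The content retrieved for instance `x` (meaningful once the retrieval is finished). -/
def content (x : Inst N) : Option Raw := (s.retrieved x).join

/-- The observation array in the block of node `k` in epoch `e`; it is constantly infinite if the
block is ill-formatted or the retrieval returned the error string. -/
def observation (P : Protocol N f Tx Raw Chunk Digest) (e : ℕ) (k j : Fin N) : ℕ∞ :=
  match (s.content (e, k)).bind P.unpack with
  | some (_, V) => (V j : ℕ∞)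
  | none => ⊤

/-- The linking estimate: the `(f + 1)`-th largest (with multiplicity) of the observations for node
`j` in the blocks committed by binary agreement in epoch `e`. The default value is irrelevant,
because at least `N - f` blocks are committed. -/
def estimate (P : Protocol N f Tx Raw Chunk Digest) (e : ℕ) (j : Fin N) : ℕ∞ :=
  (((s.committed e).val.map (fun k => s.observation P e k j)).sort (· ≥ ·)).getD f 0

/-- The blocks selected by inter-node linking in epoch `e`. -/
def Linked (P : Protocol N f Tx Raw Chunk Digest) (e : ℕ) (x : Inst N) : Prop :=
  1 ≤ x.1 ∧ (x.1 : ℕ∞) ≤ s.estimate P e x.2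

/-- The block of instance `x` has to be retrieved: it is committed by binary agreement, or it
is selected by inter-node linking in some epoch. -/
def Wanted (P : Protocol N f Tx Raw Chunk Digest) (x : Inst N) : Prop :=
  (s.Decided x.1 ∧ x.2 ∈ s.committed x.1) ∨ ∃ e, s.Downloaded e ∧ s.Linked P e x

end NodeState

/-! ## Local actions -/

/-- The actions that a correct node performs on its own. -/
inductive Action (N : ℕ) where
  | startEpoch
  | inputOne (x : Inst N)
  | inputZero (e : ℕ)
  | answer (x : Inst N) (k : Fin N)
  | request (x : Inst N)
  | decode (x : Inst N)
  | deliverCommitted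
  | deliverLinked

open Classical in
/-- `ActionStep P i a s s' o`: node `i` can perform action `a` in state `s`, which leads to state
`s'` and sends the messages `o`. -/
inductive ActionStep (P : Protocol N f Tx Raw Chunk Digest) (i : Fin N) :
    Action N → NodeState N Raw Chunk Digest → NodeState N Raw Chunk Digest →
      Outbox N Chunk Digest → Prop
  /-- Start the next epoch as soon as all binary agreement instances of the current one have
  an output. `V j` is the largest `t` such that the instances of node `j` in epochs `1, …, t` are
  complete; the block containing `V` and arbitrary transactions is dispersed. -/
  | startEpoch (s : NodeState N Raw Chunk Digest) (T : Tx) (V : Fin N → ℕ)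
      (ready : s.epoch = 0 ∨ s.Decided s.epoch)
      (largest : ∀ j, IsGreatest {t : ℕ | ∀ d, 1 ≤ d → d ≤ t → s.Complete (d, j)} (V j)) :
      ActionStep P i .startEpoch s
        { s with
          epoch := s.epoch + 1
          proposal := Function.update s.proposal (s.epoch + 1) (some (P.pack (T, V))) }
        {q | q.2 = .chunk (s.epoch + 1, i) (P.root (P.pack (T, V)))
          (P.code.encode (P.pack (T, V)) q.1) (P.proof (P.pack (T, V)) q.1)}
  /-- Input `1` once the dispersal is complete. -/
  | inputOne (s : NodeState N Raw Chunk Digest) (x : Inst N)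
      (started : 1 ≤ x.1 ∧ x.1 ≤ s.epoch) (complete : s.Complete x) (fresh : s.baIn x = none) :
      ActionStep P i (.inputOne x) s
        { s with baIn := Function.update s.baIn x (some true) } ∅
  /-- Input `0` to all remaining instances of an epoch once `N - f` of its instances output `1`. -/
  | inputZero (s : NodeState N Raw Chunk Digest) (e : ℕ)
      (started : 1 ≤ e ∧ e ≤ s.epoch) (enough : N - f ≤ (s.committed e).card)
      (fresh : ∃ j, s.baIn (e, j) = none) :
      ActionStep P i (.inputZero e) s
        { s with baIn := fun x =>
            if x.1 = e ∧ s.baIn x = none then some false else s.baIn x } ∅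
  /-- Return the own chunk to a client that requested it, if it belongs to the agreed root. -/
  | answer (s : NodeState N Raw Chunk Digest) (x : Inst N) (k : Fin N)
      (r : Digest) (c : Chunk) (π : List Digest)
      (pending : k ∈ s.asked x ∧ k ∉ s.answered x)
      (complete : s.chunkRoot x = some r) (have_chunk : s.myChunk x = some (r, c, π)) :
      ActionStep P i (.answer x k) s
        { s with answered := Function.update s.answered x (s.answered x ∪ {k}) }
        {(k, .returnChunk x r c π)}
  /-- Invoke retrieval on an instance. -/
  | request (s : NodeState N Raw Chunk Digest) (x : Inst N)
      (fresh : x ∉ s.requested) (wanted : s.Wanted P x) :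
      ActionStep P i (.request x) s
        { s with requested := s.requested ∪ {x} } (broadcast (.requestChunk x))
  /-- Decode any `N - 2 f` chunks with the same root, and check the root of the re-encoding. -/
  | decode (s : NodeState N Raw Chunk Digest) (x : Inst N) (r : Digest)
      (D : Finset (Fin N)) (C : Fin N → Option Chunk) (B : Raw)
      (running : x ∈ s.requested ∧ s.retrieved x = none) (size : D.card = N - 2 * f)
      (chunks : ∀ k ∈ D, ∃ c π, s.gathered x k = some (r, c, π) ∧ C k = some c)
      (others : ∀ k, k ∉ D → C k = none) (result : B = P.code.decode C) :
      ActionStep P i (.decode x) s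
        { s with
          retrieved :=
            Function.update s.retrieved x (some (if P.root B = r then some B else none)) } ∅
  /-- Deliver the blocks committed by binary agreement, sorted by node index. -/
  | deliverCommitted (s : NodeState N Raw Chunk Digest) (l : List (Fin N))
      (stage : s.linking = false) (downloaded : s.Downloaded (s.finished + 1))
      (sorted : l.Pairwise (· < ·))
      (blocks : ∀ j, j ∈ l ↔ j ∈ s.committed (s.finished + 1) ∧
        (P.skipDelivered = true → (s.finished + 1, j) ∉ s.delivered)) :
      ActionStep P i .deliverCommitted s
        { s with
          linking := true
          delivered := s.delivered ∪
            {x | x.1 = s.finished + 1 ∧ x.2 ∈ s.committed (s.finished + 1)}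
          log := s.log ++
            l.map (fun j => ((s.finished + 1, j), s.content (s.finished + 1, j))) } ∅
  /-- Deliver the not yet delivered linked blocks, sorted by epoch and then by node index. -/
  | deliverLinked (s : NodeState N Raw Chunk Digest) (l : List (Inst N))
      (stage : s.linking = true)
      (sorted : l.Pairwise (fun x y => toLex x < toLex y))
      (blocks : ∀ x, x ∈ l ↔ s.Linked P (s.finished + 1) x ∧ x ∉ s.delivered)
      (downloaded : ∀ x ∈ l, s.retrieved x ≠ none) :
      ActionStep P i .deliverLinked s
        { s with
          linking := false
          finished := s.finished + 1
          delivered := s.delivered ∪ {x | x ∈ l}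
          log := s.log ++ l.map (fun x => (x, s.content x)) } ∅

/-! ## Executions in an asynchronous network -/

/-- Global configuration: the local states (only those of correct nodes matter), and all messages
sent by correct nodes so far as triples (sender, receiver, message). -/
structure Config (N : ℕ) (Raw Chunk Digest : Type*) where
  node : Fin N → NodeState N Raw Chunk Digest
  sent : Set (Fin N × Fin N × Msg N Chunk Digest)

inductive Event (N : ℕ) (Chunk Digest : Type*) where
  /-- node `i` receives message `m` from node `k` -/
  | receive (i k : Fin N) (m : Msg N Chunk Digest)
  /-- node `i` performs a local action -/
  | act (i : Fin N) (a : Action N)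
  /-- node `i` gets output `b` from binary agreement instance `x` -/
  | baOutput (i : Fin N) (x : Inst N) (b : Bool)
  /-- nothing happens at correct nodes -/
  | idle

def Config.next (c : Config N Raw Chunk Digest) (i : Fin N)
    (s : NodeState N Raw Chunk Digest) (o : Outbox N Chunk Digest) :
    Config N Raw Chunk Digest where
  node := Function.update c.node i s
  sent := c.sent ∪ {p | p.1 = i ∧ p.2 ∈ o}

/-- One step of the system with set `H` of correct nodes. Senders are authenticated: a message
from a correct node is received only if that node has sent it to the receiver. A
message from a Byzantine node can be arbitrary. -/
inductive Step (P : Protocol N f Tx Raw Chunk Digest) (H : Finset (Fin N)) :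
    Config N Raw Chunk Digest → Event N Chunk Digest → Config N Raw Chunk Digest → Prop
  | receive (c : Config N Raw Chunk Digest) (i k : Fin N) (m : Msg N Chunk Digest)
      (hi : i ∈ H) (auth : k ∈ H → (k, i, m) ∈ c.sent) :
      Step P H c (.receive i k m)
        (c.next i (handle P i k (c.node i) m).1 (handle P i k (c.node i) m).2)
  | act (c : Config N Raw Chunk Digest) (i : Fin N) (a : Action N)
      (s : NodeState N Raw Chunk Digest) (o : Outbox N Chunk Digest)
      (hi : i ∈ H) (h : ActionStep P i a (c.node i) s o) :
      Step P H c (.act i a) (c.next i s o)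
  | baOutput (c : Config N Raw Chunk Digest) (i : Fin N) (x : Inst N) (b : Bool)
      (hi : i ∈ H) (fresh : (c.node i).baOut x = none) :
      Step P H c (.baOutput i x b)
        (c.next i { c.node i with
          baOut := Function.update (c.node i).baOut x (some b) } ∅)
  | idle (c : Config N Raw Chunk Digest) : Step P H c .idle c

/-- A sequence of configurations and of the events between them. -/
structure Trace (N : ℕ) (Raw Chunk Digest : Type*) where
  config : ℕ → Config N Raw Chunk Digest
  event : ℕ → Event N Chunk Digest

namespace Trace

variable (ρ : Trace N Raw Chunk Digest)

/-- The state of node `i` at time `t`. -/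
def state (t : ℕ) (i : Fin N) : NodeState N Raw Chunk Digest := (ρ.config t).node i

/-- `ρ` is an execution of the protocol with set `H` of correct nodes in an asynchronous
network: messages between correct nodes can be arbitrarily delayed but are not lost, and a correct
node does not postpone forever an action that stays enabled. -/
structure IsExecution (P : Protocol N f Tx Raw Chunk Digest) (H : Finset (Fin N)) : Prop where
  init_node : ∀ i, ρ.state 0 i = initialState N Raw Chunk Digest
  init_sent : (ρ.config 0).sent = ∅
  step : ∀ t, Step P H (ρ.config t) (ρ.event t) (ρ.config (t + 1))
  arrival : ∀ t, ∀ k ∈ H, ∀ i ∈ H, ∀ m, (k, i, m) ∈ (ρ.config t).sent →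
    ∃ t', ρ.event t' = .receive i k m
  fairness : ∀ i ∈ H, ∀ (a : Action N) (t : ℕ),
    (∀ t' ≥ t, ∃ s o, ActionStep P i a (ρ.state t' i) s o) → ∃ t' ≥ t, ρ.event t' = .act i a

/-- The defining properties of a binary agreement primitive, for the inputs and outputs that
the correct nodes have at instance `x`. -/
structure IsBinaryAgreement (H : Finset (Fin N)) (x : Inst N) : Prop where
  termination : (∀ i ∈ H, ∃ t, (ρ.state t i).baIn x ≠ none) →
    ∀ i ∈ H, ∃ t, (ρ.state t i).baOut x ≠ none
  agreement : ∀ b, ∀ i ∈ H, (∃ t, (ρ.state t i).baOut x = some b) →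
    ∀ j ∈ H, ∃ t, (ρ.state t j).baOut x = some b
  validity : ∀ b t, ∀ i ∈ H, (ρ.state t i).baOut x = some b →
    ∃ j ∈ H, (ρ.state t j).baIn x = some b

/-- The inputs that correct nodes hash at instance `x`: in the Merkle trees of the block dispersed by
a correct proposer and of the blocks successfully retrieved by correct nodes, and in the proofs of
the chunks accepted by correct nodes during retrieval. -/
def hashed (P : Protocol N f Tx Raw Chunk Digest) (H : Finset (Fin N)) (x : Inst N) :
    Set (HashInput Chunk Digest) :=
  {y | ∃ t, ∃ i ∈ H,
    (∃ B, i = x.2 ∧ (ρ.state t i).proposal x.1 = some B ∧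
      y ∈ merkleInputs P.hash (Nat.clog 2 N) (P.leaves B)) ∨
    (∃ B, (ρ.state t i).retrieved x = some (some B) ∧
      y ∈ merkleInputs P.hash (Nat.clog 2 N) (P.leaves B)) ∨
    (∃ k r c π, (ρ.state t i).gathered x k = some (r, c, π) ∧
      y ∈ pathInputs P.hash π k c)}

/-- No two different inputs that correct nodes hash at the same instance have the same digest. -/
def CollisionFree (P : Protocol N f Tx Raw Chunk Digest) (H : Finset (Fin N)) : Prop :=
  ∀ x, Set.InjOn P.hash (ρ.hashed P H x)

/-- The `n`-th block (counted from `0`) that node `i` ever delivers is `b`. -/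
def Delivers (i : Fin N) (n : ℕ) (b : Entry N Raw) : Prop :=
  ∃ t, (ρ.state t i).log[n]? = some b

/-- At time `t`, node `i` has delivered the blocks of its first `e` epochs and no others, and these
are, in this order, `L`. -/
def DeliveredAfter (i : Fin N) (e : ℕ) (t : ℕ) (L : List (Entry N Raw)) : Prop :=
  (ρ.state t i).finished = e ∧ (ρ.state t i).linking = false ∧ (ρ.state t i).log = L

end Trace

end

end

end DispersedLedger

open DispersedLedger

/-! Count the deliveries a node has finished, two per epoch (committed blocks, then linked blocks);
this is its `stage`. The theorem follows from two facts: the log of a correct node is a function of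
its stage, the same function at all correct nodes (`log_eq_of_stage_eq`), and every correct node
passes through every stage (`exists_stage_eq`).

Safety. What is delivered in an epoch is computed from the committed set, the linking estimates and
the retrieved contents, so these must be common. The committed set is, by agreement of BA. For the
contents, two quorums of `gotChunk` messages share a correct node, so an instance has at most one
agreed root (`agreed_unique`), and chunks are only ever decoded under that root. If some block with
this root has its Merkle inputs among the hashed ones, collision-freeness makes every validated
chunk a chunk of that block, so any choice of chunks decodes to it (`decodesTo_root`). Hence one
successful retrieval forces the same success everywhere, and otherwise everyone obtains the error
string (`retrieved_unique`). The estimates are computed from the first two.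

Liveness. A correct proposer's dispersal completes everywhere, so its BA instance outputs 1 unless a
correct node has already seen `N - f` outputs 1. In either case `N - f` ones appear, every remaining
instance receives input 0, and each epoch gets decided (`exists_epoch`). A committed instance is
complete at some correct node by validity of BA. A linked instance is too: one of the `f + 1`
largest observations is that of a correct node, hence finite and truthful (`complete_of_estimate`).
A completed dispersal leaves `N - 2f` correct nodes with chunks under the agreed root, so its
retrieval finishes (`eventually_retrieved`), and then the next delivery is enabled. -/

namespace DispersedLedger

/-! ### Merkle proofs: completeness and binding -/

section Merkle

variable {Chunk Digest : Type*} (hash : HashInput Chunk Digest → Digest)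

theorem length_merkleProof (d : ℕ) (C : ℕ → Option Chunk) (n : ℕ) :
    (merkleProof hash d C n).length = d := by
  induction d generalizing C n with
  | zero => rfl
  | succ d ih =>
    rw [merkleProof]
    split_ifs <;> simp [ih]

theorem pathRoot_merkleProof (d : ℕ) (C : ℕ → Option Chunk) (n : ℕ) (c : Chunk)
    (hn : n < 2 ^ d) (hc : C n = some c) :
    pathRoot hash (merkleProof hash d C n) n c = merkleRoot hash d C := by
  induction d generalizing C n with
  | zero =>
    obtain rfl : n = 0 := by simpa using hn
    simp [merkleProof, pathRoot, merkleRoot, hc]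
  | succ d ih =>
    rw [merkleProof, merkleRoot]
    split_ifs with h
    · simp [pathRoot, length_merkleProof, h, ih C n h hc]
    · have h1 : n - 2 ^ d < 2 ^ d := by rw [pow_succ] at hn; omega
      have h2 : C (n - 2 ^ d + 2 ^ d) = some c := by rw [Nat.sub_add_cancel (by omega), hc]
      simp [pathRoot, length_merkleProof, h, ih (fun m => C (m + 2 ^ d)) _ h1 h2]

/-- Binding, by descent from the root: at each level the two digests agree, both preimages lie in
`S`, so the preimages agree, and with them the digests one level below on the path. The array `C` is
arbitrary so that the induction can pass to a subtree. -/
theorem leaf_eq_of_pathRoot_eq {hash : HashInput Chunk Digest → Digest}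
    {S : Set (HashInput Chunk Digest)} (hS : Set.InjOn hash S) (π : List Digest)
    (C : ℕ → Option Chunk) (n : ℕ) (c : Chunk) (hn : n < 2 ^ π.length)
    (hπ : pathInputs hash π n c ⊆ S) (hC : merkleInputs hash π.length C ⊆ S)
    (h : pathRoot hash π n c = merkleRoot hash π.length C) : C n = some c := by
  induction π generalizing C n with
  | nil =>
    obtain rfl : n = 0 := by simpa using hn
    have := hS (hπ rfl) (hC rfl) h
    simp only [HashInput.leaf.injEq] at this
    exact this.symm
  | cons y π ih =>
    rw [List.length_cons] at hn hC h
    rw [merkleInputs, Set.union_subset_iff, Set.union_subset_iff] at hC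
    rw [merkleRoot, pathRoot] at h
    rw [pathInputs] at hπ
    split_ifs at h hπ with hlt
    · rw [Set.union_subset_iff] at hπ
      have := hS (hπ.1 rfl) (hC.1.1 rfl) h
      simp only [HashInput.node.injEq] at this
      exact ih C n hlt hπ.2 hC.1.2 this.1
    · rw [Set.union_subset_iff] at hπ
      have := hS (hπ.1 rfl) (hC.1.1 rfl) h
      simp only [HashInput.node.injEq] at this
      have := ih _ (n - 2 ^ π.length) (by rw [pow_succ] at hn; omega) hπ.2 hC.2 this.2
      rwa [Nat.sub_add_cancel (by omega)] at this

end Merkle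

/-! ### Quorum counting -/

section Counting

variable {N f : ℕ} {Digest : Type*} {H : Finset (Fin N)}

theorem card_le_card_inter_add (hH : Hᶜ.card ≤ f) (D : Finset (Fin N)) :
    D.card ≤ (D ∩ H).card + f := by
  rw [← Finset.card_inter_add_card_sdiff D H]
  gcongr
  exact (Finset.card_le_card fun k hk => by simp_all).trans hH

theorem sub_le_card (hH : Hᶜ.card ≤ f) : N - f ≤ H.card := by
  have := H.card_compl
  simp at this
  omega

theorem exists_finset_card_eq_rootCount (v : Fin N → Option Digest) (r : Digest) :
    ∃ D : Finset (Fin N), D.card = rootCount v r ∧ ∀ k, k ∈ D ↔ v k = some r := by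
  classical
  refine ⟨Finset.univ.filter fun k => v k = some r, ?_, by simp⟩
  rw [rootCount, ← Set.ncard_coe_finset]
  simp

theorem card_le_rootCount {v : Fin N → Option Digest} {r : Digest} {D : Finset (Fin N)}
    (hD : ∀ k ∈ D, v k = some r) : D.card ≤ rootCount v r := by
  obtain ⟨D', hc, hD'⟩ := exists_finset_card_eq_rootCount v r
  rw [← hc]
  exact Finset.card_le_card fun k hk => (hD' k).2 (hD k hk)

theorem rootCount_mono {v w : Fin N → Option Digest} {r : Digest}
    (h : ∀ k, v k = some r → w k = some r) : rootCount v r ≤ rootCount w r :=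
  Set.ncard_le_ncard h

theorem exists_correct_subset (hH : Hᶜ.card ≤ f) {v : Fin N → Option Digest} {r : Digest} {n : ℕ}
    (h : n ≤ rootCount v r) : ∃ D ⊆ H, n - f = D.card ∧ ∀ k ∈ D, v k = some r := by
  obtain ⟨D, hc, hD⟩ := exists_finset_card_eq_rootCount v r
  have := card_le_card_inter_add hH D
  obtain ⟨D', h1, h2⟩ := Finset.exists_subset_card_eq (show n - f ≤ (D ∩ H).card by omega)
  exact ⟨D', fun k hk => (Finset.mem_inter.1 (h1 hk)).2, h2.symm,
    fun k hk => (hD k).1 (Finset.mem_inter.1 (h1 hk)).1⟩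

theorem exists_correct_of_rootCount (hH : Hᶜ.card ≤ f) {v : Fin N → Option Digest} {r : Digest}
    (h : f + 1 ≤ rootCount v r) : ∃ k ∈ H, v k = some r := by
  obtain ⟨D, hD, hc, h⟩ := exists_correct_subset hH h
  obtain ⟨k, hk⟩ := Finset.card_pos.1 (show 0 < D.card by omega)
  exact ⟨k, hD hk, h k hk⟩

theorem exists_correct_of_card (hH : Hᶜ.card ≤ f) {D : Finset (Fin N)}
    (h : f + 1 ≤ D.card) : ∃ k ∈ H, k ∈ D := by
  have := card_le_card_inter_add hH D
  obtain ⟨k, hk⟩ := Finset.card_pos.1 (show 0 < (D ∩ H).card by omega)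
  simp only [Finset.mem_inter] at hk
  exact ⟨k, hk.2, hk.1⟩

theorem exists_correct_of_quorums (hN : 3 * f + 1 ≤ N) (hH : Hᶜ.card ≤ f)
    {v w : Fin N → Option Digest} {r r' : Digest}
    (hv : N - f ≤ rootCount v r) (hw : N - f ≤ rootCount w r') :
    ∃ k ∈ H, v k = some r ∧ w k = some r' := by
  obtain ⟨D, hc, hD⟩ := exists_finset_card_eq_rootCount v r
  obtain ⟨D', hc', hD'⟩ := exists_finset_card_eq_rootCount w r'
  have h1 := Finset.card_union_add_card_inter D D'
  have h2 : (D ∪ D').card ≤ N := by simpa using Finset.card_le_univ (D ∪ D')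
  -- The intersection has at least `2 (N - f) - N = N - 2f` elements, which is at least `f + 1`.
  obtain ⟨k, hk, hk'⟩ := exists_correct_of_card hH (show f + 1 ≤ (D ∩ D').card by omega)
  simp only [Finset.mem_inter] at hk'
  exact ⟨k, hk, (hD k).1 hk'.1, (hD' k).1 hk'.2⟩

/-- Among the `f + 1` largest of more than `f` values, one belongs to a correct node. -/
theorem exists_correct_getD_sort_le (hH : Hᶜ.card ≤ f) {S : Finset (Fin N)} (hS : f + 1 ≤ S.card)
    (g : Fin N → ℕ∞) :
    ∃ k ∈ H, k ∈ S ∧ ((S.val.map g).sort (· ≥ ·)).getD f 0 ≤ g k := by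
  set l := (S.val.map g).sort (· ≥ ·) with hl
  have hlen : l.length = S.card := by simp [hl]
  have hf : f < l.length := by omega
  rw [List.getD_eq_getElem _ _ hf]
  have hpw : l.Pairwise (· ≥ ·) := Multiset.pairwise_sort _ _
  -- Instead of following positions through the sort, count the entries that are at least `l[f]`:
  -- the first `f + 1` qualify, and the count carries over to `S` through the multiset, even with
  -- ties.
  have h1 : f + 1 ≤ (l.filter (fun a => l[f] ≤ a)).length := by
    have hsub : (l.take (f + 1)).filter (fun a => l[f] ≤ a) = l.take (f + 1) := by
      rw [List.filter_eq_self]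
      intro a ha
      obtain ⟨n, hn, rfl⟩ := List.mem_iff_getElem.1 ha
      rw [List.length_take] at hn
      rw [List.getElem_take, decide_eq_true_iff]
      rcases (show n ≤ f by omega).eq_or_lt with rfl | hlt
      · exact le_rfl
      · exact List.pairwise_iff_getElem.1 hpw n f _ _ hlt
    have := ((List.take_sublist (f + 1) l).filter (fun a => decide (l[f] ≤ a))).length_le
    rw [hsub, List.length_take] at this
    omega
  have h2 : (l.filter (fun a => l[f] ≤ a)).length = (S.filter (fun k => l[f] ≤ g k)).card := by
    have : (↑l : Multiset ℕ∞) = S.val.map g := Multiset.sort_eq _ _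
    rw [← Multiset.coe_card, ← Multiset.filter_coe, this, Multiset.filter_map, Multiset.card_map]
    rfl
  obtain ⟨k, hk, hk'⟩ := exists_correct_of_card hH (h2 ▸ h1)
  rw [Finset.mem_filter] at hk'
  exact ⟨k, hk, hk'⟩

end Counting

theorem update_update_eq_some_iff {α β γ : Type*} [DecidableEq α] [DecidableEq β]
    (g : α → β → Option γ) (x y : α) (k m : β) (a b : γ) :
    Function.update g x (Function.update (g x) k (some a)) y m = some b ↔
      (y = x ∧ m = k ∧ a = b) ∨ (¬(y = x ∧ m = k) ∧ g y m = some b) := by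
  by_cases h : y = x
  · subst h
    by_cases h : m = k
    · subst h
      simp
    · simp [h]
  · simp [h]

/-! ### Steps of a single node -/

section Local

variable {N f : ℕ} {Tx Raw Chunk Digest : Type*}

open Classical in
/-- A step as seen by node `i`, where `A k m` tells whether message `m` can arrive from `k`. -/
inductive LocalStep (P : Protocol N f Tx Raw Chunk Digest) (i : Fin N)
    (A : Fin N → Msg N Chunk Digest → Prop) (s : NodeState N Raw Chunk Digest) :
      NodeState N Raw Chunk Digest → Outbox N Chunk Digest → Prop
  | stutter : LocalStep P i A s s ∅
  | chunk (k : Fin N) (x : Inst N) (r : Digest) (c : Chunk) (π : List Digest)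
      (auth : A k (.chunk x r c π)) (owner : k = x.2) (fresh : s.myChunk x = none)
      (valid : P.Verify r i c π) :
      LocalStep P i A s { s with myChunk := Function.update s.myChunk x (some (r, c, π)) }
        (broadcast (.gotChunk x r))
  | gotChunk (k : Fin N) (x : Inst N) (r : Digest) (auth : A k (.gotChunk x r))
      (fresh : s.gotFrom x k = none) :
      LocalStep P i A s
        { s with
            gotFrom := Function.update s.gotFrom x
              (Function.update (s.gotFrom x) k (some r)) }
        (if N - f ≤ rootCount (Function.update (s.gotFrom x) k (some r)) r then
          broadcast (.ready x r) else ∅)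
  | ready (k : Fin N) (x : Inst N) (r : Digest) (auth : A k (.ready x r))
      (fresh : s.readyFrom x k = none) :
      LocalStep P i A s
        { s with
            readyFrom := Function.update s.readyFrom x
              (Function.update (s.readyFrom x) k (some r))
            chunkRoot :=
              if 2 * f + 1 ≤ rootCount (Function.update (s.readyFrom x) k (some r)) r then
                Function.update s.chunkRoot x (some r) else s.chunkRoot }
        (if f + 1 ≤ rootCount (Function.update (s.readyFrom x) k (some r)) r then
          broadcast (.ready x r) else ∅)
  | requestChunk (k : Fin N) (x : Inst N) (auth : A k (.requestChunk x)) :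
      LocalStep P i A s
        { s with asked := Function.update s.asked x (s.asked x ∪ {k}) } ∅
  | returnChunk (k : Fin N) (x : Inst N) (r : Digest) (c : Chunk) (π : List Digest)
      (auth : A k (.returnChunk x r c π)) (running : x ∈ s.requested)
      (fresh : s.gathered x k = none) (valid : P.Verify r k c π) :
      LocalStep P i A s
        { s with
            gathered := Function.update s.gathered x
              (Function.update (s.gathered x) k (some (r, c, π))) } ∅
  | baOutput (x : Inst N) (b : Bool) (fresh : s.baOut x = none) :
      LocalStep P i A s { s with baOut := Function.update s.baOut x (some b) } ∅
  | act (a : Action N) (s' : NodeState N Raw Chunk Digest) (o : Outbox N Chunk Digest)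
      (h : ActionStep P i a s s' o) : LocalStep P i A s s' o

variable {P : Protocol N f Tx Raw Chunk Digest} {i : Fin N}
  {A : Fin N → Msg N Chunk Digest → Prop} {s s' : NodeState N Raw Chunk Digest}
  {o : Outbox N Chunk Digest}

theorem LocalStep.of_handle {k : Fin N} {m : Msg N Chunk Digest} (h : A k m) :
    LocalStep P i A s (handle P i k s m).1 (handle P i k s m).2 := by
  cases m with
  | chunk x r c π =>
    rw [handle]
    split_ifs with h'
    exacts [.chunk k x r c π h h'.1 h'.2.1 h'.2.2, .stutter]
  | gotChunk x r =>
    rw [handle]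
    split_ifs with h'
    exacts [.gotChunk k x r h h', .stutter]
  | ready x r =>
    rw [handle]
    split_ifs with h'
    exacts [.ready k x r h h', .stutter]
  | requestChunk x => exact .requestChunk k x h
  | returnChunk x r c π =>
    rw [handle]
    split_ifs with h'
    exacts [.returnChunk k x r c π h h'.1 h'.2.1 h'.2.2, .stutter]

/-- The number of deliveries that a node has finished, two for each epoch. -/
def NodeState.stage (s : NodeState N Raw Chunk Digest) : ℕ :=
  2 * s.finished + if s.linking then 1 else 0

/-- The parts of the local state that persist. -/
structure NodeState.Extends (s s' : NodeState N Raw Chunk Digest) : Prop where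
  myChunk : ∀ x a, s.myChunk x = some a → s'.myChunk x = some a
  gotFrom : ∀ x k r, s.gotFrom x k = some r → s'.gotFrom x k = some r
  readyFrom : ∀ x k r, s.readyFrom x k = some r → s'.readyFrom x k = some r
  -- Only completeness persists locally, not the value of `chunkRoot`: a second root with `2f + 1`
  -- `ready` messages would overwrite it, and excluding this takes a quorum argument across nodes.
  complete : ∀ x, s.Complete x → s'.Complete x
  asked : ∀ x, s.asked x ⊆ s'.asked x
  requested : s.requested ⊆ s'.requested
  gathered : ∀ x k a, s.gathered x k = some a → s'.gathered x k = some a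
  retrieved : ∀ x a, s.retrieved x = some a → s'.retrieved x = some a
  baIn : ∀ x b, s.baIn x = some b → s'.baIn x = some b
  baOut : ∀ x b, s.baOut x = some b → s'.baOut x = some b
  epoch : s.epoch ≤ s'.epoch
  -- Limited to started epochs, because `startEpoch` writes the entry at `s.epoch + 1`.
  proposal : ∀ e ≤ s.epoch, s'.proposal e = s.proposal e
  stage : s.stage ≤ s'.stage
  log : s.log <+: s'.log

theorem LocalStep.extends (h : LocalStep P i A s s' o) : s.Extends s' := by
  constructor
  all_goals
    cases h <;> (try cases ‹ActionStep _ _ _ _ _ _›)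
  all_goals
    try first
      | exact fun _ _ h => h
      | exact fun _ _ _ h => h
      | exact fun _ h => h
      | exact fun _ => subset_rfl
      | exact subset_rfl
      | exact le_rfl
      | exact fun _ _ => rfl
      | exact List.prefix_rfl
      | exact List.prefix_append _ _
  all_goals
    try simp only [NodeState.Complete, NodeState.stage, update_update_eq_some_iff]
    grind

@[simp] theorem mem_broadcast {q : Fin N} {m m' : Msg N Chunk Digest} :
    ((q, m) ∈ broadcast m') ↔ m = m' := Iff.rfl

/-- Freshness of the entry matters: overwriting an earlier root would lower the count of that root.
-/
theorem rootCount_update_update {v : Inst N → Fin N → Option Digest} {x y : Inst N} {k : Fin N}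
    {r r' : Digest} [DecidableEq (Inst N)] [DecidableEq (Fin N)] (hv : v x k = none) :
    (y = x ∧ r' = r) ∨
      rootCount (Function.update v x (Function.update (v x) k (some r)) y) r' =
        rootCount (v y) r' := by
  by_cases h : y = x ∧ r' = r
  · exact .inl h
  · refine .inr (congrArg Set.ncard (Set.ext fun m => ?_))
    simp only [Set.mem_ofPred_eq, update_update_eq_some_iff]
    grind

/-- Block `B` can be decoded from chunks of `x` that were gathered with root `r`. -/
def NodeState.DecodesTo (P : Protocol N f Tx Raw Chunk Digest)
    (s : NodeState N Raw Chunk Digest) (x : Inst N) (r : Digest) (B : Raw) : Prop :=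
  ∃ (D : Finset (Fin N)) (C : Fin N → Option Chunk), D.card = N - 2 * f ∧
    (∀ k ∈ D, ∃ c π, s.gathered x k = some (r, c, π) ∧ C k = some c) ∧
    (∀ k, k ∉ D → C k = none) ∧ B = P.code.decode C

/-- In epoch `e`, node `i` has dispersed a block with a truthful observation array. -/
def NodeState.Proposed (P : Protocol N f Tx Raw Chunk Digest)
    (s : NodeState N Raw Chunk Digest) (i : Fin N)
    (o : Outbox N Chunk Digest) (e : ℕ) : Prop :=
  ∃ T V, s.proposal e = some (P.pack (T, V)) ∧
    (∀ j d, 1 ≤ d → d ≤ V j → s.Complete (d, j)) ∧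
    ∀ q, (q, .chunk (e, i) (P.root (P.pack (T, V)))
      (P.code.encode (P.pack (T, V)) q) (P.proof (P.pack (T, V)) q)) ∈ o

/-! ### Causes and effects of a step, for inductions over time -/

namespace LocalStep

theorem gotFrom_origin (h : LocalStep P i A s s' o) {x : Inst N} {k : Fin N} {r : Digest}
    (h' : s'.gotFrom x k = some r) : s.gotFrom x k = some r ∨ A k (.gotChunk x r) := by
  cases h <;> (try cases ‹ActionStep _ _ _ _ _ _›) <;> try exact .inl h'
  rw [update_update_eq_some_iff] at h'
  grind

theorem readyFrom_origin (h : LocalStep P i A s s' o) {x : Inst N} {k : Fin N} {r : Digest}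
    (h' : s'.readyFrom x k = some r) : s.readyFrom x k = some r ∨ A k (.ready x r) := by
  cases h <;> (try cases ‹ActionStep _ _ _ _ _ _›) <;> try exact .inl h'
  rw [update_update_eq_some_iff] at h'
  grind

theorem gathered_origin (h : LocalStep P i A s s' o) {x : Inst N} {k : Fin N} {r : Digest}
    {c : Chunk} {π : List Digest} (h' : s'.gathered x k = some (r, c, π)) :
    s.gathered x k = some (r, c, π) ∨ (A k (.returnChunk x r c π) ∧ P.Verify r k c π) := by
  cases h <;> (try cases ‹ActionStep _ _ _ _ _ _›) <;> try exact .inl h'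
  rw [update_update_eq_some_iff] at h'
  grind

theorem myChunk_origin (h : LocalStep P i A s s' o) {x : Inst N} {r : Digest}
    {c : Chunk} {π : List Digest} (h' : s'.myChunk x = some (r, c, π)) :
    s.myChunk x = some (r, c, π) ∨ (A x.2 (.chunk x r c π) ∧ P.Verify r i c π ∧
      ∀ q, (q, .gotChunk x r) ∈ o) := by
  cases h <;> (try cases ‹ActionStep _ _ _ _ _ _›) <;> try exact .inl h'
  simp only [Function.update_apply] at h'
  simp only [mem_broadcast]
  grind

theorem asked_origin (h : LocalStep P i A s s' o) {x : Inst N} {k : Fin N}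
    (h' : k ∈ s'.asked x) : k ∈ s.asked x ∨ A k (.requestChunk x) := by
  cases h <;> (try cases ‹ActionStep _ _ _ _ _ _›) <;> try exact .inl h'
  simp only [Function.update_apply] at h'
  grind

theorem answered_origin (h : LocalStep P i A s s' o) {x : Inst N} {k : Fin N}
    (h' : k ∈ s'.answered x) : k ∈ s.answered x ∨
      ∃ r c π, s.myChunk x = some (r, c, π) ∧ s.chunkRoot x = some r ∧
        (k, .returnChunk x r c π) ∈ o := by
  cases h <;> (try cases ‹ActionStep _ _ _ _ _ _›) <;> try exact .inl h'
  simp only [Function.update_apply] at h'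
  grind

theorem requested_origin (h : LocalStep P i A s s' o) {x : Inst N}
    (h' : x ∈ s'.requested) : x ∈ s.requested ∨ ∀ q, (q, .requestChunk x) ∈ o := by
  cases h <;> (try cases ‹ActionStep _ _ _ _ _ _›) <;> try exact .inl h'
  simp only [mem_broadcast]
  grind

theorem gotChunk_origin (h : LocalStep P i A s s' o) {x : Inst N} {q : Fin N} {r : Digest}
    (h' : (q, .gotChunk x r) ∈ o) : ∃ c π, s'.myChunk x = some (r, c, π) := by
  cases h <;> (try cases ‹ActionStep _ _ _ _ _ _›) <;> (try split_ifs at h') <;>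
    simp_all

theorem chunk_origin (h : LocalStep P i A s s' o) {x : Inst N} {q : Fin N} {r : Digest}
    {c : Chunk} {π : List Digest} (h' : (q, .chunk x r c π) ∈ o) :
    x.2 = i ∧ x.1 ≤ s'.epoch ∧ ∃ B, s'.proposal x.1 = some B ∧ r = P.root B := by
  cases h <;> (try cases ‹ActionStep _ _ _ _ _ _›) <;> (try split_ifs at h') <;>
    simp_all

theorem ready_origin (h : LocalStep P i A s s' o) {x : Inst N} {q : Fin N} {r : Digest}
    (h' : (q, .ready x r) ∈ o) :
    N - f ≤ rootCount (s'.gotFrom x) r ∨ f + 1 ≤ rootCount (s'.readyFrom x) r := by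
  cases h <;> (try cases ‹ActionStep _ _ _ _ _ _›) <;> (try split_ifs at h') <;>
    simp_all

theorem ready_broadcast (h : LocalStep P i A s s' o) {x : Inst N} {q : Fin N} {r : Digest}
    (h' : (q, .ready x r) ∈ o) (q' : Fin N) : (q', .ready x r) ∈ o := by
  cases h <;> (try cases ‹ActionStep _ _ _ _ _ _›) <;> (try split_ifs at h' ⊢) <;>
    simp_all

theorem requestChunk_origin (h : LocalStep P i A s s' o) {x : Inst N} {q : Fin N}
    (h' : (q, .requestChunk x) ∈ o) : x ∈ s'.requested := by
  cases h <;> (try cases ‹ActionStep _ _ _ _ _ _›) <;> (try split_ifs at h') <;>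
    simp_all

theorem returnChunk_origin (h : LocalStep P i A s s' o) {x : Inst N} {q : Fin N} {r : Digest}
    {c : Chunk} {π : List Digest} (h' : (q, .returnChunk x r c π) ∈ o) :
    q ∈ s'.asked x ∧ s'.myChunk x = some (r, c, π) ∧ s'.chunkRoot x = some r := by
  cases h <;> (try cases ‹ActionStep _ _ _ _ _ _›) <;> (try split_ifs at h') <;>
    simp_all

/-- A step can change only the count of the root it has just received, and this is the count the
handler tests; so a newly reached threshold is noticed in the same step. The next two lemmas rest on
the same observation. -/
theorem ready_of_gotFrom (h : LocalStep P i A s s' o) {x : Inst N} {r : Digest}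
    (h' : N - f ≤ rootCount (s'.gotFrom x) r) :
    N - f ≤ rootCount (s.gotFrom x) r ∨ ∀ q, (q, .ready x r) ∈ o := by
  cases h <;> (try cases ‹ActionStep _ _ _ _ _ _›) <;> try exact .inl h'
  rename_i k y r' _ fresh
  rcases rootCount_update_update (y := x) (r := r') (r' := r) fresh with ⟨rfl, rfl⟩ | h
  · dsimp only at h'
    rw [Function.update_self] at h'
    simp [h']
  · exact .inl (h ▸ h')

theorem ready_of_readyFrom (h : LocalStep P i A s s' o) {x : Inst N} {r : Digest}
    (h' : f + 1 ≤ rootCount (s'.readyFrom x) r) :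
    f + 1 ≤ rootCount (s.readyFrom x) r ∨ ∀ q, (q, .ready x r) ∈ o := by
  cases h <;> (try cases ‹ActionStep _ _ _ _ _ _›) <;> try exact .inl h'
  rename_i k y r' _ fresh
  rcases rootCount_update_update (y := x) (r := r') (r' := r) fresh with ⟨rfl, rfl⟩ | h
  · dsimp only at h'
    rw [Function.update_self] at h'
    simp [h']
  · exact .inl (h ▸ h')

theorem complete_of_readyFrom (h : LocalStep P i A s s' o) {x : Inst N} {r : Digest}
    (h' : 2 * f + 1 ≤ rootCount (s'.readyFrom x) r) :
    2 * f + 1 ≤ rootCount (s.readyFrom x) r ∨ s'.Complete x := by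
  cases h <;> (try cases ‹ActionStep _ _ _ _ _ _›) <;> try exact .inl h'
  rename_i k y r' _ fresh
  rcases rootCount_update_update (y := x) (r := r') (r' := r) fresh with ⟨rfl, rfl⟩ | h
  · dsimp only at h'
    rw [Function.update_self] at h'
    simp [h', NodeState.Complete]
  · exact .inl (h ▸ h')

theorem chunkRoot_origin (h : LocalStep P i A s s' o) {x : Inst N} {r : Digest}
    (h' : s'.chunkRoot x = some r) :
    s.chunkRoot x = some r ∨ 2 * f + 1 ≤ rootCount (s'.readyFrom x) r := by
  cases h <;> (try cases ‹ActionStep _ _ _ _ _ _›) <;> try exact .inl h'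
  rename_i k y r' _ fresh
  dsimp only at h' ⊢
  split_ifs at h' with hc
  · by_cases hx : x = y
    · subst hx
      simp_all
    · simp_all
  · exact .inl h'

/-- This gives finiteness of the set of completed instances at any time, and so the existence of the
array `V` in `startEpoch`. -/
theorem complete_origin (h : LocalStep P i A s s' o) :
    ∃ y, ∀ x, s'.Complete x → s.Complete x ∨ x = y := by
  by_cases h' : ∀ x, s'.Complete x → s.Complete x
  -- Nothing is newly complete, so the instance `(0, i)` is arbitrary.
  · exact ⟨(0, i), fun x hx => .inl (h' x hx)⟩
  cases h <;> (try cases ‹ActionStep _ _ _ _ _ _›) <;> try exact absurd (fun _ h => h) h'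
  rename_i k y r' _ fresh
  refine ⟨y, fun x hx => or_iff_not_imp_right.2 fun hxy => ?_⟩
  simp only [NodeState.Complete] at hx ⊢
  split_ifs at hx <;> simp_all

open Classical in
theorem retrieved_origin (h : LocalStep P i A s s' o) {x : Inst N} {a : Option Raw}
    (h' : s'.retrieved x = some a) : s.retrieved x = some a ∨
      ∃ r B, s'.DecodesTo P x r B ∧ a = if P.root B = r then some B else none := by
  cases h <;> (try cases ‹ActionStep _ _ _ _ _ _›) <;> try exact .inl h'
  rename_i y r D C B size others result _ chunks
  simp only [Function.update_apply] at h'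
  split_ifs at h' with hx hB
  · subst hx
    exact .inr ⟨r, B, ⟨D, C, size, chunks, others, result⟩, by simp_all⟩
  · subst hx
    exact .inr ⟨r, B, ⟨D, C, size, chunks, others, result⟩, by simp_all⟩
  · exact .inl h'

theorem baIn_true_origin (h : LocalStep P i A s s' o) {x : Inst N}
    (h' : s'.baIn x = some true) : s.baIn x = some true ∨ s'.Complete x := by
  cases h <;> (try cases ‹ActionStep _ _ _ _ _ _›) <;> try exact .inl h'
  · simp only [Function.update_apply] at h'
    split_ifs at h' with hx
    · exact .inr (by subst hx; assumption)
    · exact .inl h'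
  · dsimp only at h'
    split_ifs at h'
    · simp at h'
    · exact .inl h'

theorem baIn_false_origin (h : LocalStep P i A s s' o) {x : Inst N}
    (h' : s'.baIn x = some false) :
    s.baIn x = some false ∨ N - f ≤ (s'.committed x.1).card := by
  cases h <;> (try cases ‹ActionStep _ _ _ _ _ _›) <;> try exact .inl h'
  · simp only [Function.update_apply] at h'
    split_ifs at h' with hx
    · simp at h'
    · exact .inl h'
  · dsimp only at h'
    split_ifs at h' with hx
    · exact .inr (by rw [hx.1]; assumption)
    · exact .inl h'

theorem epoch_origin (h : LocalStep P i A s s' o) :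
    s'.epoch = s.epoch ∨ (s'.epoch = s.epoch + 1 ∧ s'.Proposed P i o s'.epoch) := by
  cases h <;> (try cases ‹ActionStep _ _ _ _ _ _›) <;> try exact .inl rfl
  rename_i T V _ largest
  refine .inr ⟨rfl, T, V, by simp, fun j => (largest j).1, fun q => ?_⟩
  simp

theorem proposal_origin (h : LocalStep P i A s s' o) {e : ℕ} {B : Raw}
    (h' : s'.proposal e = some B) : s.proposal e = some B ∨ (1 ≤ e ∧ e ≤ s'.epoch) := by
  cases h <;> (try cases ‹ActionStep _ _ _ _ _ _›) <;> try exact .inl h'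
  simp only [Function.update_apply] at h'
  split_ifs at h' with he
  · exact .inr (by simp [he])
  · exact .inl h'

/-- With this bound no stage can be jumped over. -/
theorem stage_le (h : LocalStep P i A s s' o) : s'.stage ≤ s.stage + 1 := by
  cases h <;> (try cases ‹ActionStep _ _ _ _ _ _›) <;> try exact Nat.le_succ _
  all_goals simp_all [NodeState.stage]; try omega

theorem linking_origin (h : LocalStep P i A s s' o) (h' : s'.linking = true) :
    s'.Downloaded (s'.finished + 1) ∨
      (s.linking = true ∧ s'.finished = s.finished) := by
  cases h <;> (try cases ‹ActionStep _ _ _ _ _ _›) <;> (try exact .inr ⟨h', rfl⟩) <;>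
    (try exact .inl ‹_›); simp_all

end LocalStep

end Local

/-! ### Invariants of executions -/

section Executions

variable {N f : ℕ} {Tx Raw Chunk Digest : Type*}
variable {P : Protocol N f Tx Raw Chunk Digest} {H : Finset (Fin N)}
  {ρ : Trace N Raw Chunk Digest}

namespace NodeState.Extends

variable {s s' s'' : NodeState N Raw Chunk Digest}

theorem refl (s : NodeState N Raw Chunk Digest) : s.Extends s := by
  constructor <;> simp

theorem trans (h : s.Extends s') (h' : s'.Extends s'') : s.Extends s'' where
  myChunk x a ha := h'.myChunk x a (h.myChunk x a ha)
  gotFrom x k r hr := h'.gotFrom x k r (h.gotFrom x k r hr)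
  readyFrom x k r hr := h'.readyFrom x k r (h.readyFrom x k r hr)
  complete x hx := h'.complete x (h.complete x hx)
  asked x := (h.asked x).trans (h'.asked x)
  requested := h.requested.trans h'.requested
  gathered x k a ha := h'.gathered x k a (h.gathered x k a ha)
  retrieved x a ha := h'.retrieved x a (h.retrieved x a ha)
  baIn x b hb := h'.baIn x b (h.baIn x b hb)
  baOut x b hb := h'.baOut x b (h.baOut x b hb)
  epoch := h.epoch.trans h'.epoch
  proposal e he := (h'.proposal e (he.trans h.epoch)).trans (h.proposal e he)
  stage := h.stage.trans h'.stage
  log := h.log.trans h'.log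

theorem committed_subset (h : s.Extends s') (e : ℕ) : s.committed e ⊆ s'.committed e := by
  intro j hj
  simp only [committed, Finset.mem_filter, Finset.mem_univ, true_and] at hj ⊢
  exact h.baOut _ _ hj

theorem baOut_eq_of_ne_none (h : s.Extends s') {x : Inst N} (hx : s.baOut x ≠ none) :
    s'.baOut x = s.baOut x := by
  obtain ⟨b, hb⟩ := Option.ne_none_iff_exists'.1 hx
  rw [h.baOut x b hb, hb]

theorem retrieved_eq_of_ne_none (h : s.Extends s') {x : Inst N} (hx : s.retrieved x ≠ none) :
    s'.retrieved x = s.retrieved x := by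
  obtain ⟨b, hb⟩ := Option.ne_none_iff_exists'.1 hx
  rw [h.retrieved x b hb, hb]

theorem decided (h : s.Extends s') {e : ℕ} (he : s.Decided e) : s'.Decided e :=
  ⟨he.1, he.2.1.trans h.epoch, fun j => by
    rw [h.baOut_eq_of_ne_none (he.2.2 j)]
    exact he.2.2 j⟩

theorem committed_eq (h : s.Extends s') {e : ℕ} (he : s.Decided e) :
    s'.committed e = s.committed e := by
  ext j
  simp [committed, h.baOut_eq_of_ne_none (he.2.2 j)]

theorem downloaded (h : s.Extends s') {e : ℕ} (he : s.Downloaded e) : s'.Downloaded e := by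
  refine ⟨h.decided he.1, fun j hj => ?_⟩
  rw [h.committed_eq he.1] at hj
  rw [h.retrieved_eq_of_ne_none (he.2 j hj)]
  exact he.2 j hj

end NodeState.Extends

theorem NodeState.DecodesTo.mono {s s' : NodeState N Raw Chunk Digest} (h : s.Extends s')
    {x : Inst N} {r : Digest} {B : Raw} (hB : s.DecodesTo P x r B) : s'.DecodesTo P x r B := by
  obtain ⟨D, C, size, chunks, others, result⟩ := hB
  refine ⟨D, C, size, fun k hk => ?_, others, result⟩
  obtain ⟨c, π, h1, h2⟩ := chunks k hk
  exact ⟨c, π, h.gathered _ _ _ h1, h2⟩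

namespace Trace

/-- Message `m` from `k` to `q` was sent before time `t`. -/
abbrev Sent (ρ : Trace N Raw Chunk Digest) (t : ℕ) (k q : Fin N) (m : Msg N Chunk Digest) :
    Prop :=
  (k, q, m) ∈ (ρ.config t).sent

theorem IsExecution.sent_zero (exec : ρ.IsExecution P H) {k q : Fin N} {m : Msg N Chunk Digest} :
    ¬ρ.Sent 0 k q m := by
  simp [Sent, exec.init_sent]

theorem IsExecution.sent_succ (exec : ρ.IsExecution P H) {t : ℕ} {k q : Fin N}
    {m : Msg N Chunk Digest} (h : ρ.Sent t k q m) : ρ.Sent (t + 1) k q m := by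
  have hs := exec.step t
  simp only [Sent] at h ⊢
  generalize ρ.config t = c at *
  generalize ρ.event t = ev at *
  generalize ρ.config (t + 1) = c' at *
  cases hs
  all_goals first | exact h | exact .inl h

theorem IsExecution.sent_mono (exec : ρ.IsExecution P H) {t t' : ℕ} (htt : t ≤ t') {k q : Fin N}
    {m : Msg N Chunk Digest} (h : ρ.Sent t k q m) : ρ.Sent t' k q m := by
  induction t', htt using Nat.le_induction with
  | base => exact h
  | succ t' _ ih => exact exec.sent_succ ih

theorem IsExecution.localStep (exec : ρ.IsExecution P H) (i : Fin N) (t : ℕ) :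
    ∃ o, LocalStep P i (fun k m => k ∈ H → ρ.Sent t k i m) (ρ.state t i) (ρ.state (t + 1) i) o ∧
      ∀ q m, ρ.Sent (t + 1) i q m ↔ ρ.Sent t i q m ∨ (q, m) ∈ o := by
  have hs := exec.step t
  simp only [Sent, Trace.state]
  generalize ρ.config t = c at *
  generalize ρ.event t = ev at *
  generalize ρ.config (t + 1) = c' at *
  cases hs with
  | idle => exact ⟨∅, .stutter, by simp⟩
  | receive j k m hj auth =>
    by_cases hij : i = j
    · subst hij
      exact ⟨_, by simpa [Config.next] using LocalStep.of_handle auth, by simp [Config.next]⟩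
    · exact ⟨∅, by simpa [Config.next, hij] using LocalStep.stutter, by simp [Config.next, hij]⟩
  | act j a s o hj h =>
    by_cases hij : i = j
    · subst hij
      exact ⟨o, by simpa [Config.next] using LocalStep.act a s o h, by simp [Config.next]⟩
    · exact ⟨∅, by simpa [Config.next, hij] using LocalStep.stutter, by simp [Config.next, hij]⟩
  | baOutput j x b hj h =>
    by_cases hij : i = j
    · subst hij
      exact ⟨∅, by simpa [Config.next] using LocalStep.baOutput x b h, by simp [Config.next]⟩
    · exact ⟨∅, by simpa [Config.next, hij] using LocalStep.stutter, by simp [Config.next]⟩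

theorem IsExecution.extends (exec : ρ.IsExecution P H) (i : Fin N) {t t' : ℕ}
    (htt : t ≤ t') : (ρ.state t i).Extends (ρ.state t' i) := by
  induction t', htt using Nat.le_induction with
  | base => exact .refl _
  | succ t' _ ih =>
    obtain ⟨o, h, -⟩ := exec.localStep i t'
    exact ih.trans h.extends

variable {i k : Fin N} {t : ℕ} {x : Inst N} {q : Fin N} {r : Digest} {c : Chunk}
  {π : List Digest}

namespace IsExecution

theorem sent_gotChunk (exec : ρ.IsExecution P H)
    (h : ρ.Sent t i q (.gotChunk x r)) : ∃ c π, (ρ.state t i).myChunk x = some (r, c, π) := by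
  induction t with
  | zero => exact (exec.sent_zero h).elim
  | succ t ih =>
    obtain ⟨o, hl, ho⟩ := exec.localStep i t
    rcases (ho _ _).1 h with h | h
    · obtain ⟨c, π, h⟩ := ih h
      exact ⟨c, π, hl.extends.myChunk _ _ h⟩
    · exact hl.gotChunk_origin h

theorem sent_of_gotFrom (exec : ρ.IsExecution P H) (hk : k ∈ H)
    (h : (ρ.state t i).gotFrom x k = some r) : ρ.Sent t k i (.gotChunk x r) := by
  induction t with
  | zero => simp [exec.init_node, initialState] at h
  | succ t ih =>
    obtain ⟨o, hl, -⟩ := exec.localStep i t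
    exact exec.sent_succ ((hl.gotFrom_origin h).elim ih fun h => h hk)

theorem sent_of_readyFrom (exec : ρ.IsExecution P H) (hk : k ∈ H)
    (h : (ρ.state t i).readyFrom x k = some r) : ρ.Sent t k i (.ready x r) := by
  induction t with
  | zero => simp [exec.init_node, initialState] at h
  | succ t ih =>
    obtain ⟨o, hl, -⟩ := exec.localStep i t
    exact exec.sent_succ ((hl.readyFrom_origin h).elim ih fun h => h hk)

theorem of_myChunk (exec : ρ.IsExecution P H)
    (h : (ρ.state t i).myChunk x = some (r, c, π)) :
    P.Verify r i c π ∧ (x.2 ∈ H → ρ.Sent t x.2 i (.chunk x r c π)) ∧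
      ∀ q, ρ.Sent t i q (.gotChunk x r) := by
  induction t with
  | zero => simp [exec.init_node, initialState] at h
  | succ t ih =>
    obtain ⟨o, hl, ho⟩ := exec.localStep i t
    rcases hl.myChunk_origin h with h | ⟨h1, h2, h3⟩
    · obtain ⟨h1, h2, h3⟩ := ih h
      exact ⟨h1, fun hx => exec.sent_succ (h2 hx), fun q => exec.sent_succ (h3 q)⟩
    · exact ⟨h2, fun hx => exec.sent_succ (h1 hx), fun q => (ho _ _).2 (.inr (h3 q))⟩

/-- Since the proposal of a started epoch is fixed, a correct proposer uses a single root per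
instance. -/
theorem sent_chunk (exec : ρ.IsExecution P H)
    (h : ρ.Sent t i q (.chunk x r c π)) :
    x.2 = i ∧ x.1 ≤ (ρ.state t i).epoch ∧
      ∃ B, (ρ.state t i).proposal x.1 = some B ∧ r = P.root B := by
  induction t with
  | zero => exact (exec.sent_zero h).elim
  | succ t ih =>
    obtain ⟨o, hl, ho⟩ := exec.localStep i t
    rcases (ho _ _).1 h with h | h
    · obtain ⟨h1, h2, h3⟩ := ih h
      exact ⟨h1, h2.trans hl.extends.epoch, by rwa [hl.extends.proposal _ h2]⟩
    · exact hl.chunk_origin h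

theorem proposal_epoch (exec : ρ.IsExecution P H) {e : ℕ} {B : Raw}
    (h : (ρ.state t i).proposal e = some B) : 1 ≤ e ∧ e ≤ (ρ.state t i).epoch := by
  induction t with
  | zero => simp [exec.init_node, initialState] at h
  | succ t ih =>
    obtain ⟨o, hl, ho⟩ := exec.localStep i t
    rcases hl.proposal_origin h with h | h
    · exact ⟨(ih h).1, (ih h).2.trans hl.extends.epoch⟩
    · exact h

theorem proposed (exec : ρ.IsExecution P H) {e : ℕ} (h1 : 1 ≤ e)
    (h2 : e ≤ (ρ.state t i).epoch) :
    (ρ.state t i).Proposed P i {p | ρ.Sent t i p.1 p.2} e := by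
  induction t with
  | zero => simp [exec.init_node, initialState] at h2; omega
  | succ t ih =>
    obtain ⟨o, hl, ho⟩ := exec.localStep i t
    by_cases h3 : e ≤ (ρ.state t i).epoch
    · obtain ⟨T, V, hp, hV, hs⟩ := ih h3
      exact ⟨T, V, by rw [hl.extends.proposal e h3, hp],
        fun j d hd hd' => hl.extends.complete _ (hV j d hd hd'), fun q => exec.sent_succ (hs q)⟩
    · rcases hl.epoch_origin with h | ⟨h, h'⟩
      · omega
      · obtain rfl : e = (ρ.state (t + 1) i).epoch := by omega
        obtain ⟨T, V, hp, hV, hs⟩ := h'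
        exact ⟨T, V, hp, hV,
          fun q => (ho _ _).2 (.inr (hs q))⟩

theorem sent_requestChunk (exec : ρ.IsExecution P H)
    (h : ρ.Sent t i q (.requestChunk x)) : x ∈ (ρ.state t i).requested := by
  induction t with
  | zero => exact (exec.sent_zero h).elim
  | succ t ih =>
    obtain ⟨o, hl, ho⟩ := exec.localStep i t
    rcases (ho _ _).1 h with h | h
    · exact hl.extends.requested (ih h)
    · exact hl.requestChunk_origin h

theorem sent_of_requested (exec : ρ.IsExecution P H)
    (h : x ∈ (ρ.state t i).requested) (q : Fin N) : ρ.Sent t i q (.requestChunk x) := by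
  induction t with
  | zero => simp [exec.init_node, initialState] at h
  | succ t ih =>
    obtain ⟨o, hl, ho⟩ := exec.localStep i t
    exact (ho _ _).2 ((hl.requested_origin h).imp ih fun h => h q)

theorem sent_of_asked (exec : ρ.IsExecution P H) (hk : k ∈ H)
    (h : k ∈ (ρ.state t i).asked x) : ρ.Sent t k i (.requestChunk x) := by
  induction t with
  | zero => simp [exec.init_node, initialState] at h
  | succ t ih =>
    obtain ⟨o, hl, ho⟩ := exec.localStep i t
    exact exec.sent_succ ((hl.asked_origin h).elim ih fun h => h hk)

theorem readyFrom_of_chunkRoot (exec : ρ.IsExecution P H)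
    (h : (ρ.state t i).chunkRoot x = some r) :
    2 * f + 1 ≤ rootCount ((ρ.state t i).readyFrom x) r := by
  induction t with
  | zero => simp [exec.init_node, initialState] at h
  | succ t ih =>
    obtain ⟨o, hl, ho⟩ := exec.localStep i t
    rcases hl.chunkRoot_origin h with h | h
    · exact (ih h).trans (rootCount_mono fun k => hl.extends.readyFrom x k r)
    · exact h

theorem complete_of_readyFrom (exec : ρ.IsExecution P H)
    (h : 2 * f + 1 ≤ rootCount ((ρ.state t i).readyFrom x) r) : (ρ.state t i).Complete x := by
  induction t with
  | zero => simp [exec.init_node, initialState, rootCount] at h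
  | succ t ih =>
    obtain ⟨o, hl, ho⟩ := exec.localStep i t
    exact (hl.complete_of_readyFrom h).elim (fun h => hl.extends.complete x (ih h)) id

theorem sent_ready_of_gotFrom (exec : ρ.IsExecution P H) (hf : f < N)
    (h : N - f ≤ rootCount ((ρ.state t i).gotFrom x) r) (q : Fin N) :
    ρ.Sent t i q (.ready x r) := by
  induction t with
  -- The count is zero initially, and the threshold `N - f` is positive because `f < N`.
  | zero => simp [exec.init_node, initialState, rootCount] at h; omega
  | succ t ih =>
    obtain ⟨o, hl, ho⟩ := exec.localStep i t
    exact (ho _ _).2 ((hl.ready_of_gotFrom h).imp ih fun h => h q)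

theorem sent_ready_of_readyFrom (exec : ρ.IsExecution P H)
    (h : f + 1 ≤ rootCount ((ρ.state t i).readyFrom x) r) (q : Fin N) :
    ρ.Sent t i q (.ready x r) := by
  induction t with
  | zero => simp [exec.init_node, initialState, rootCount] at h
  | succ t ih =>
    obtain ⟨o, hl, ho⟩ := exec.localStep i t
    exact (ho _ _).2 ((hl.ready_of_readyFrom h).imp ih fun h => h q)

/-- The agreed root is expressed by the count of `ready` messages, which is monotone in time, rather
than by `chunkRoot`, which is not yet known to be stable. -/
theorem sent_returnChunk (exec : ρ.IsExecution P H)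
    (h : ρ.Sent t i q (.returnChunk x r c π)) :
    q ∈ (ρ.state t i).asked x ∧ (ρ.state t i).myChunk x = some (r, c, π) ∧
      2 * f + 1 ≤ rootCount ((ρ.state t i).readyFrom x) r := by
  induction t with
  | zero => exact (exec.sent_zero h).elim
  | succ t ih =>
    obtain ⟨o, hl, ho⟩ := exec.localStep i t
    rcases (ho _ _).1 h with h | h
    · obtain ⟨h1, h2, h3⟩ := ih h
      exact ⟨hl.extends.asked x h1, hl.extends.myChunk _ _ h2,
        h3.trans (rootCount_mono fun k => hl.extends.readyFrom x k r)⟩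
    · obtain ⟨h1, h2, h3⟩ := hl.returnChunk_origin h
      exact ⟨h1, h2, exec.readyFrom_of_chunkRoot h3⟩

theorem sent_of_answered (exec : ρ.IsExecution P H)
    (h : q ∈ (ρ.state t i).answered x) :
    ∃ r c π, (ρ.state t i).myChunk x = some (r, c, π) ∧ ρ.Sent t i q (.returnChunk x r c π) := by
  induction t with
  | zero => simp [exec.init_node, initialState] at h
  | succ t ih =>
    obtain ⟨o, hl, ho⟩ := exec.localStep i t
    rcases hl.answered_origin h with h | ⟨r, c, π, h1, -, h3⟩
    · obtain ⟨r, c, π, h1, h2⟩ := ih h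
      exact ⟨r, c, π, hl.extends.myChunk _ _ h1, exec.sent_succ h2⟩
    · exact ⟨r, c, π, hl.extends.myChunk _ _ h1, (ho _ _).2 (.inr h3)⟩

theorem of_gathered (exec : ρ.IsExecution P H)
    (h : (ρ.state t i).gathered x k = some (r, c, π)) :
    P.Verify r k c π ∧ (k ∈ H → ρ.Sent t k i (.returnChunk x r c π)) := by
  induction t with
  | zero => simp [exec.init_node, initialState] at h
  | succ t ih =>
    obtain ⟨o, hl, ho⟩ := exec.localStep i t
    rcases hl.gathered_origin h with h | ⟨h1, h2⟩
    · exact ⟨(ih h).1, fun hk => exec.sent_succ ((ih h).2 hk)⟩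
    · exact ⟨h2, fun hk => exec.sent_succ (h1 hk)⟩

theorem finite_complete (exec : ρ.IsExecution P H) (i : Fin N) (t : ℕ) :
    {x | (ρ.state t i).Complete x}.Finite := by
  induction t with
  | zero => simp [exec.init_node, initialState, NodeState.Complete]
  | succ t ih =>
    obtain ⟨o, hl, ho⟩ := exec.localStep i t
    obtain ⟨y, hy⟩ := hl.complete_origin
    exact (ih.union (Set.finite_singleton y)).subset hy

open Classical in
theorem of_retrieved (exec : ρ.IsExecution P H) {a : Option Raw}
    (h : (ρ.state t i).retrieved x = some a) :
    ∃ r B, (ρ.state t i).DecodesTo P x r B ∧ a = if P.root B = r then some B else none := by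
  induction t with
  | zero => simp [exec.init_node, initialState] at h
  | succ t ih =>
    obtain ⟨o, hl, ho⟩ := exec.localStep i t
    rcases hl.retrieved_origin h with h | h
    · obtain ⟨r, B, h1, h2⟩ := ih h
      exact ⟨r, B, h1.mono hl.extends, h2⟩
    · exact h

theorem complete_of_baIn (exec : ρ.IsExecution P H)
    (h : (ρ.state t i).baIn x = some true) : (ρ.state t i).Complete x := by
  induction t with
  | zero => simp [exec.init_node, initialState] at h
  | succ t ih =>
    obtain ⟨o, hl, ho⟩ := exec.localStep i t
    exact (hl.baIn_true_origin h).elim (fun h => hl.extends.complete x (ih h)) id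

theorem card_committed_of_baIn (exec : ρ.IsExecution P H)
    (h : (ρ.state t i).baIn x = some false) :
    N - f ≤ ((ρ.state t i).committed x.1).card := by
  induction t with
  | zero => simp [exec.init_node, initialState] at h
  | succ t ih =>
    obtain ⟨o, hl, ho⟩ := exec.localStep i t
    exact (hl.baIn_false_origin h).elim (fun h => (ih h).trans
      (Finset.card_le_card (hl.extends.committed_subset _))) id

/-- `deliverLinked` does not itself demand that the committed blocks are downloaded; this invariant
supplies it, so that the estimate used there is the common one. -/
theorem downloaded_of_linking (exec : ρ.IsExecution P H)
    (h : (ρ.state t i).linking = true) :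
    (ρ.state t i).Downloaded ((ρ.state t i).finished + 1) := by
  induction t with
  | zero => simp [exec.init_node, initialState] at h
  | succ t ih =>
    obtain ⟨o, hl, ho⟩ := exec.localStep i t
    rcases hl.linking_origin h with h | ⟨h, h'⟩
    · exact h
    · rw [h']
      exact hl.extends.downloaded (ih h)

end IsExecution

end Trace

end Executions

/-! ### Safety: common roots, contents, estimates and logs -/

section Executions

variable {N f : ℕ} {Tx Raw Chunk Digest : Type*}
variable {P : Protocol N f Tx Raw Chunk Digest} {H : Finset (Fin N)}
  {ρ : Trace N Raw Chunk Digest} {i j k : Fin N} {t t' : ℕ} {x : Inst N} {q : Fin N}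
  {r r' : Digest} {c : Chunk} {π : List Digest}

namespace Trace

/-! ### Agreed roots -/

/-- Some correct node has received `N - f` messages `gotChunk` with root `r`. -/
def Agreed (ρ : Trace N Raw Chunk Digest) (f : ℕ) (H : Finset (Fin N)) (x : Inst N)
    (r : Digest) : Prop :=
  ∃ t, ∃ i ∈ H, N - f ≤ rootCount ((ρ.state t i).gotFrom x) r

namespace IsExecution

/-- A `ready` caused by `f + 1` others has a correct node among its causes, which sent its own
`ready` strictly earlier. Going back in time, the chain ends at a `gotChunk` quorum. -/
theorem agreed_of_sent_ready (exec : ρ.IsExecution P H) (hH : Hᶜ.card ≤ f) (hi : i ∈ H)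
    (h : ρ.Sent t i q (.ready x r)) : ρ.Agreed f H x r := by
  induction t generalizing i q with
  | zero => exact (exec.sent_zero h).elim
  | succ t ih =>
    obtain ⟨o, hl, ho⟩ := exec.localStep i t
    rcases (ho _ _).1 h with h | h
    · exact ih hi h
    · rcases hl.ready_origin h with h | h
      · exact ⟨t + 1, i, hi, h⟩
      · obtain ⟨k, hk, hr⟩ := exists_correct_of_rootCount hH h
        rcases hl.readyFrom_origin hr with h | h
        · exact ih hk (exec.sent_of_readyFrom hk h)
        · exact ih hk (h hk)

theorem agreed_of_readyFrom (exec : ρ.IsExecution P H) (hH : Hᶜ.card ≤ f)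
    (h : f + 1 ≤ rootCount ((ρ.state t i).readyFrom x) r) : ρ.Agreed f H x r := by
  obtain ⟨k, hk, hr⟩ := exists_correct_of_rootCount hH h
  exact exec.agreed_of_sent_ready hH hk (exec.sent_of_readyFrom hk hr)

/-- The two quorums share a correct node, and every `gotChunk` it sends carries the root in
`myChunk`, which never changes once set. -/
theorem agreed_unique (exec : ρ.IsExecution P H) (hN : 3 * f + 1 ≤ N) (hH : Hᶜ.card ≤ f)
    (h : ρ.Agreed f H x r) (h' : ρ.Agreed f H x r') : r = r' := by
  obtain ⟨t, i, hi, h⟩ := h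
  obtain ⟨t', i', hi', h'⟩ := h'
  obtain ⟨k, hk, hr, hr'⟩ := exists_correct_of_quorums hN hH h h'
  obtain ⟨c, π, h⟩ := exec.sent_gotChunk
    (exec.sent_mono (le_max_left t t') (exec.sent_of_gotFrom hk hr))
  obtain ⟨c', π', h'⟩ := exec.sent_gotChunk
    (exec.sent_mono (le_max_right t t') (exec.sent_of_gotFrom hk hr'))
  simp_all

/-- Of the `N - f` senders at most `f` are Byzantine, and the correct ones have stored their chunk.
These holders are what makes retrieval possible. -/
theorem exists_myChunk_of_agreed (exec : ρ.IsExecution P H) (hH : Hᶜ.card ≤ f)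
    (h : ρ.Agreed f H x r) : ∃ t, ∃ D ⊆ H, D.card = N - 2 * f ∧
      ∀ k ∈ D, ∃ c π, (ρ.state t k).myChunk x = some (r, c, π) := by
  obtain ⟨t, i, hi, h⟩ := h
  obtain ⟨D, hD, hc, h⟩ := exists_correct_subset hH h
  exact ⟨t, D, hD, by omega,
    fun k hk => exec.sent_gotChunk (exec.sent_of_gotFrom (hD hk) (h k hk))⟩

theorem agreed_eq_root (exec : ρ.IsExecution P H) (hN : 3 * f + 1 ≤ N) (hH : Hᶜ.card ≤ f)
    (h : ρ.Agreed f H x r) (hx : x.2 ∈ H) :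
    ∃ t B, (ρ.state t x.2).proposal x.1 = some B ∧ r = P.root B := by
  obtain ⟨t, D, hD, hc, h⟩ := exec.exists_myChunk_of_agreed hH h
  obtain ⟨k, hk⟩ := Finset.card_pos.1 (show 0 < D.card by omega)
  obtain ⟨c, π, hm⟩ := h k hk
  exact ⟨t, (exec.sent_chunk ((exec.of_myChunk hm).2.1 hx)).2.2⟩

/-- Among `N - 2f ≥ f + 1` chunks one was returned by a correct node, which had seen `2f + 1`
`ready` messages for the same root. -/
theorem agreed_of_decodesTo (exec : ρ.IsExecution P H) (hN : 3 * f + 1 ≤ N) (hH : Hᶜ.card ≤ f)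
    {B : Raw} (h : (ρ.state t i).DecodesTo P x r B) : ρ.Agreed f H x r := by
  obtain ⟨D, C, size, chunks, -, -⟩ := h
  obtain ⟨k, hk, hk'⟩ := exists_correct_of_card hH (show f + 1 ≤ D.card by omega)
  obtain ⟨c, π, hg, -⟩ := chunks k hk'
  exact exec.agreed_of_readyFrom hH
    ((show f + 1 ≤ 2 * f + 1 by omega).trans
      (exec.sent_returnChunk ((exec.of_gathered hg).2 hk)).2.2)

/-! ### Retrieval -/

/-- By Merkle binding each gathered chunk is the chunk of `B'` at its position, so the decoder is
run on exactly the input for which the erasure code guarantees `B'`. -/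
theorem decodesTo_root (exec : ρ.IsExecution P H) (coll : ρ.CollisionFree P H) (hi : i ∈ H)
    {B B' : Raw} (hB' : merkleInputs P.hash (Nat.clog 2 N) (P.leaves B') ⊆ ρ.hashed P H x)
    (h : (ρ.state t i).DecodesTo P x (P.root B') B) : B = B' := by
  obtain ⟨D, C, size, chunks, others, result⟩ := h
  rw [result, ← P.code.decode_encode B' D size]
  congr 1
  funext m
  split_ifs with hm
  · obtain ⟨c, π, hg, hc⟩ := chunks m hm
    obtain ⟨hlen, hroot⟩ := (exec.of_gathered hg).1
    have := leaf_eq_of_pathRoot_eq (coll x) π (P.leaves B') m c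
      (hlen ▸ m.2.trans_le (Nat.le_pow_clog one_lt_two N))
      (fun y hy => ⟨t, i, hi, .inr (.inr ⟨m, _, c, π, hg, hy⟩)⟩) (hlen ▸ hB') (hlen ▸ hroot)
    simpa [Protocol.leaves, hc, eq_comm] using this
  · exact others m hm

/-- Both nodes decode under the same root. If the check of the re-encoding succeeds at one of them,
the inputs of that block count as hashed, and `decodesTo_root` forces the other node to decode the
same block. If it succeeds at neither, both hold the error string. -/
theorem retrieved_unique (exec : ρ.IsExecution P H) (coll : ρ.CollisionFree P H)
    (hN : 3 * f + 1 ≤ N) (hH : Hᶜ.card ≤ f) (hi : i ∈ H) (hj : j ∈ H) {a a' : Option Raw}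
    (h : (ρ.state t i).retrieved x = some a) (h' : (ρ.state t' j).retrieved x = some a') :
    a = a' := by
  obtain ⟨r, B, hd, ha⟩ := exec.of_retrieved h
  obtain ⟨r', B', hd', ha'⟩ := exec.of_retrieved h'
  obtain rfl := exec.agreed_unique hN hH (exec.agreed_of_decodesTo hN hH hd)
    (exec.agreed_of_decodesTo hN hH hd')
  by_cases hr : P.root B = r
  · rw [if_pos hr] at ha
    subst ha hr
    obtain rfl := exec.decodesTo_root coll hj
      (fun y hy => ⟨t, i, hi, .inr (.inl ⟨B, h, hy⟩)⟩) hd'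
    rw [ha', if_pos rfl]
  · by_cases hr' : P.root B' = r
    · rw [if_pos hr'] at ha'
      subst ha' hr'
      obtain rfl := exec.decodesTo_root coll hi
        (fun y hy => ⟨t', j, hj, .inr (.inl ⟨B', h', hy⟩)⟩) hd
      exact absurd rfl hr
    · rw [ha, ha', if_neg hr, if_neg hr']

/-- The agreed root is that of the proposer's own block, whose Merkle inputs are among the hashed
ones, so the check cannot fail. -/
theorem retrieved_correct (exec : ρ.IsExecution P H) (coll : ρ.CollisionFree P H)
    (hN : 3 * f + 1 ≤ N) (hH : Hᶜ.card ≤ f) (hi : i ∈ H) (hx : x.2 ∈ H) {a : Option Raw}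
    (h : (ρ.state t i).retrieved x = some a) :
    ∃ t B, (ρ.state t x.2).proposal x.1 = some B ∧ a = some B := by
  obtain ⟨r, B, hd, ha⟩ := exec.of_retrieved h
  obtain ⟨t', B', hp, rfl⟩ := exec.agreed_eq_root hN hH (exec.agreed_of_decodesTo hN hH hd) hx
  obtain rfl := exec.decodesTo_root coll hi
    (fun y hy => ⟨t', x.2, hx, .inl ⟨B', rfl, hp, hy⟩⟩) hd
  exact ⟨t', B, hp, by rw [ha, if_pos rfl]⟩

/-! ### Binary agreement and linking -/

theorem baOut_unique (exec : ρ.IsExecution P H) (ba : ∀ x, ρ.IsBinaryAgreement H x)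
    (hi : i ∈ H) (hj : j ∈ H) {b b' : Bool} (h : (ρ.state t i).baOut x = some b)
    (h' : (ρ.state t' j).baOut x = some b') : b = b' := by
  obtain ⟨u, hu⟩ := (ba x).agreement b i hi ⟨t, h⟩ j hj
  have h1 := (exec.extends j (le_max_left u t')).baOut _ _ hu
  have h2 := (exec.extends j (le_max_right u t')).baOut _ _ h'
  simp_all

theorem committed_unique (exec : ρ.IsExecution P H) (ba : ∀ x, ρ.IsBinaryAgreement H x)
    (hi : i ∈ H) (hj : j ∈ H) {e : ℕ} (h : (ρ.state t i).Decided e)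
    (h' : (ρ.state t' j).Decided e) : (ρ.state t i).committed e = (ρ.state t' j).committed e := by
  ext k
  obtain ⟨b, hb⟩ := Option.ne_none_iff_exists'.1 (h.2.2 k)
  obtain ⟨b', hb'⟩ := Option.ne_none_iff_exists'.1 (h'.2.2 k)
  obtain rfl := exec.baOut_unique ba hi hj hb hb'
  simp [NodeState.committed, hb, hb']

/-- An output 0 goes back to a correct node that gave input 0, which it does only after seeing `N -
f` outputs 1; agreement transfers these. Without any output 0, all `N` instances are committed. -/
theorem le_card_committed (exec : ρ.IsExecution P H) (ba : ∀ x, ρ.IsBinaryAgreement H x)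
    (hi : i ∈ H) {e : ℕ} (h : (ρ.state t i).Decided e) :
    N - f ≤ ((ρ.state t i).committed e).card := by
  by_cases hf : ∃ k, (ρ.state t i).baOut (e, k) = some false
  · obtain ⟨k, hk⟩ := hf
    obtain ⟨j, hj, hin⟩ := (ba _).validity _ _ i hi hk
    refine (exec.card_committed_of_baIn hin).trans (Finset.card_le_card fun m hm => ?_)
    obtain ⟨b, hb⟩ := Option.ne_none_iff_exists'.1 (h.2.2 m)
    simp only [NodeState.committed, Finset.mem_filter, Finset.mem_univ, true_and] at hm ⊢
    rw [hb, exec.baOut_unique ba hi hj hb hm]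
  · have : (ρ.state t i).committed e = Finset.univ := by
      ext m
      obtain ⟨b, hb⟩ := Option.ne_none_iff_exists'.1 (h.2.2 m)
      cases b
      · exact absurd ⟨m, hb⟩ hf
      · simp [NodeState.committed, hb]
    simp [this]

theorem estimate_unique (exec : ρ.IsExecution P H) (coll : ρ.CollisionFree P H)
    (ba : ∀ x, ρ.IsBinaryAgreement H x) (hN : 3 * f + 1 ≤ N) (hH : Hᶜ.card ≤ f)
    (hi : i ∈ H) (hj : j ∈ H) {e : ℕ} (h : (ρ.state t i).Downloaded e)
    (h' : (ρ.state t' j).Downloaded e) :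
    (ρ.state t i).estimate P e = (ρ.state t' j).estimate P e := by
  funext m
  have hc := exec.committed_unique ba hi hj h.1 h'.1
  simp only [NodeState.estimate]
  rw [← hc]
  congr 2
  refine Multiset.map_congr rfl fun k hk => ?_
  obtain ⟨a, ha⟩ := Option.ne_none_iff_exists'.1 (h.2 k hk)
  obtain ⟨a', ha'⟩ := Option.ne_none_iff_exists'.1 (h'.2 k (hc ▸ hk))
  obtain rfl := exec.retrieved_unique coll hN hH hi hj ha ha'
  simp [NodeState.observation, NodeState.content, ha, ha']

/-- One of the `f + 1` largest observations belongs to a correct node. Its array is finite and lists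
only instances complete at that node, so infinite or inflated arrays of Byzantine nodes cannot push
the estimate beyond it. -/
theorem complete_of_estimate (exec : ρ.IsExecution P H) (coll : ρ.CollisionFree P H)
    (ba : ∀ x, ρ.IsBinaryAgreement H x) (hN : 3 * f + 1 ≤ N) (hH : Hᶜ.card ≤ f)
    (hi : i ∈ H) {e : ℕ} (h : (ρ.state t i).Downloaded e) (m : Fin N) :
    ∃ n : ℕ, (ρ.state t i).estimate P e m ≤ n ∧
      ∃ k ∈ H, ∃ t', ∀ d, 1 ≤ d → d ≤ n → (ρ.state t' k).Complete (d, m) := by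
  obtain ⟨k, hk, hkc, hle⟩ := exists_correct_getD_sort_le hH
    ((show f + 1 ≤ N - f by omega).trans (exec.le_card_committed ba hi h.1))
    (fun k => (ρ.state t i).observation P e k m)
  obtain ⟨a, ha⟩ := Option.ne_none_iff_exists'.1 (h.2 k hkc)
  obtain ⟨t', B, hp, rfl⟩ := exec.retrieved_correct (x := (e, k)) coll hN hH hi hk ha
  obtain ⟨h1, h2⟩ := exec.proposal_epoch hp
  obtain ⟨T, V, hp', hV, -⟩ := exec.proposed h1 h2
  obtain rfl := Option.some.inj (hp.symm.trans hp')
  refine ⟨V m, hle.trans ?_, k, hk, t', hV m⟩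
  simp [NodeState.observation, NodeState.content, ha, P.unpack_pack]

end IsExecution

/-! ### The common log -/

/-- The log and the delivered instances of a node that has finished `e` epochs and, if the flag is
set, the delivery of the committed blocks of the next one, as determined by the committed sets `S`,
the linking estimates `E` and the retrieved contents `R`. -/
inductive CommonLog (skip : Bool) (S : ℕ → Finset (Fin N)) (E : ℕ → Fin N → ℕ∞)
    (R : Inst N → Option Raw) : ℕ → Bool → List (Entry N Raw) → Set (Inst N) → Prop
  | nil : CommonLog skip S E R 0 false [] ∅
  | committed {e : ℕ} {L : List (Entry N Raw)} {D : Set (Inst N)}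
      (prev : CommonLog skip S E R e false L D) (l : List (Fin N)) (sorted : l.Pairwise (· < ·))
      (blocks : ∀ j, j ∈ l ↔ j ∈ S (e + 1) ∧ (skip = true → (e + 1, j) ∉ D)) :
      CommonLog skip S E R e true (L ++ l.map fun j => ((e + 1, j), R (e + 1, j)))
        (D ∪ {x | x.1 = e + 1 ∧ x.2 ∈ S (e + 1)})
  | linked {e : ℕ} {L : List (Entry N Raw)} {D : Set (Inst N)}
      (prev : CommonLog skip S E R e true L D) (l : List (Inst N))
      (sorted : l.Pairwise fun x y => toLex x < toLex y)
      (blocks : ∀ x, x ∈ l ↔ (1 ≤ x.1 ∧ (x.1 : ℕ∞) ≤ E (e + 1) x.2) ∧ x ∉ D) :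
      CommonLog skip S E R (e + 1) false (L ++ l.map fun x => (x, R x)) (D ∪ {x | x ∈ l})

/-- A strictly sorted list is determined by its members, so each stage has only one possible
continuation. -/
theorem CommonLog.unique {skip : Bool} {S : ℕ → Finset (Fin N)} {E : ℕ → Fin N → ℕ∞}
    {R : Inst N → Option Raw} {e : ℕ} {b : Bool} {L L' : List (Entry N Raw)}
    {D D' : Set (Inst N)} (h : CommonLog skip S E R e b L D)
    (h' : CommonLog skip S E R e b L' D') : L = L' ∧ D = D' := by
  induction h generalizing L' D' with
  | nil => cases h'; exact ⟨rfl, rfl⟩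
  | committed prev l sorted blocks ih =>
    cases h' with
    | committed prev' l' sorted' blocks' =>
      obtain ⟨rfl, rfl⟩ := ih prev'
      obtain rfl : l = l' := sorted.eq_of_mem_iff sorted' fun j => by rw [blocks, blocks']
      exact ⟨rfl, rfl⟩
  | linked prev l sorted blocks ih =>
    cases h' with
    | linked prev' l' sorted' blocks' =>
      obtain ⟨rfl, rfl⟩ := ih prev'
      obtain rfl : l = l' := by
        have : Std.Asymm fun x y : Inst N => toLex x < toLex y := ⟨fun _ _ => lt_asymm⟩
        exact sorted.eq_of_mem_iff sorted' fun j => by rw [blocks, blocks']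
      exact ⟨rfl, rfl⟩

/-- The common data are read off from any correct node that ever determines them, since all such
nodes agree. -/
theorem IsExecution.exists_commonLog (exec : ρ.IsExecution P H) (coll : ρ.CollisionFree P H)
    (ba : ∀ x, ρ.IsBinaryAgreement H x) (hN : 3 * f + 1 ≤ N) (hH : Hᶜ.card ≤ f) :
    ∃ S E R, ∀ i ∈ H, ∀ t, CommonLog P.skipDelivered S E R (ρ.state t i).finished
      (ρ.state t i).linking (ρ.state t i).log (ρ.state t i).delivered := by
  have hS : ∀ e, ∃ S : Finset (Fin N), ∀ i ∈ H, ∀ t, (ρ.state t i).Decided e →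
      (ρ.state t i).committed e = S := by
    intro e
    by_cases h : ∃ i ∈ H, ∃ t, (ρ.state t i).Decided e
    · obtain ⟨j, hj, t', h⟩ := h
      exact ⟨_, fun i hi t h' => exec.committed_unique ba hi hj h' h⟩
    -- No correct node ever decides this epoch, so the default is never consulted; likewise for the
    -- defaults of `E` and `R`.
    · exact ⟨∅, fun i hi t h' => (h ⟨i, hi, t, h'⟩).elim⟩
  have hE : ∀ e, ∃ E : Fin N → ℕ∞, ∀ i ∈ H, ∀ t, (ρ.state t i).Downloaded e →
      (ρ.state t i).estimate P e = E := by
    intro e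
    by_cases h : ∃ i ∈ H, ∃ t, (ρ.state t i).Downloaded e
    · obtain ⟨j, hj, t', h⟩ := h
      exact ⟨_, fun i hi t h' => exec.estimate_unique coll ba hN hH hi hj h' h⟩
    · exact ⟨0, fun i hi t h' => (h ⟨i, hi, t, h'⟩).elim⟩
  have hR : ∀ x, ∃ R : Option Raw, ∀ i ∈ H, ∀ t, (ρ.state t i).retrieved x ≠ none →
      (ρ.state t i).content x = R := by
    intro x
    by_cases h : ∃ i ∈ H, ∃ t, (ρ.state t i).retrieved x ≠ none
    · obtain ⟨j, hj, t', h⟩ := h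
      refine ⟨(ρ.state t' j).content x, fun i hi t h' => ?_⟩
      obtain ⟨a, ha⟩ := Option.ne_none_iff_exists'.1 h
      obtain ⟨a', ha'⟩ := Option.ne_none_iff_exists'.1 h'
      obtain rfl := exec.retrieved_unique coll hN hH hi hj ha' ha
      simp only [NodeState.content, ha, ha']
    · exact ⟨none, fun i hi t h' => (h ⟨i, hi, t, h'⟩).elim⟩
  choose S hS using hS
  choose E hE using hE
  choose R hR using hR
  refine ⟨S, E, R, fun i hi t => ?_⟩
  induction t with
  | zero => simpa [exec.init_node, initialState] using CommonLog.nil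
  | succ t ih =>
    obtain ⟨o, hl, -⟩ := exec.localStep i t
    have hlink := exec.downloaded_of_linking (t := t) (i := i)
    have hS' := hS ((ρ.state t i).finished + 1) i hi t
    have hE' := hE ((ρ.state t i).finished + 1) i hi t
    have hR' := fun x => hR x i hi t
    clear hS hE hR
    generalize ρ.state t i = s at *
    generalize ρ.state (t + 1) i = s' at *
    cases hl <;> (try cases ‹ActionStep _ _ _ _ _ _›) <;> try exact ih
    · rename_i l sorted stage downloaded blocks
      rw [stage] at ih
      have := ih.committed l sorted (by rw [← hS' downloaded.1]; exact blocks)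
      rw [← hS' downloaded.1] at this
      convert this using 2
      refine List.map_congr_left fun j hj => ?_
      rw [hR' _ (downloaded.2 j ((blocks j).1 hj).1)]
    · rename_i l sorted stage blocks downloaded
      rw [stage] at ih
      have := ih.linked l sorted (by rw [← hE' (hlink stage)]; exact blocks)
      convert this using 2
      refine List.map_congr_left fun x hx => ?_
      rw [hR' _ (downloaded x hx)]

end Trace

end Executions

/-! ### Liveness: messages, dispersals and epochs -/

section Executions

variable {N f : ℕ} {Tx Raw Chunk Digest : Type*}
variable {P : Protocol N f Tx Raw Chunk Digest} {H : Finset (Fin N)}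
  {ρ : Trace N Raw Chunk Digest} {i j k : Fin N} {t t' : ℕ} {x : Inst N} {q : Fin N}
  {r r' : Digest} {c : Chunk} {π : List Digest}

open Filter

/-- Progress is phrased along `atTop`, so that finitely many persistent facts hold simultaneously
without handling maxima of times. -/
theorem eventually_of_persistent {p : ℕ → Prop} (hp : ∀ t t', t ≤ t' → p t → p t')
    (h : ∃ t, p t) : ∀ᶠ t in atTop, p t := by
  obtain ⟨t, ht⟩ := h
  filter_upwards [eventually_ge_atTop t] with t' htt using hp t t' htt ht

namespace Trace

namespace IsExecution

/-! ### Reception and fairness -/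

/-- `arrival` says nothing about when the message is received; authentication in the receiving step
shows that it has been sent by then. -/
theorem exists_receive (exec : ρ.IsExecution P H) (hk : k ∈ H) (hi : i ∈ H)
    {m : Msg N Chunk Digest} (h : ρ.Sent t k i m) :
    ∃ t', ρ.Sent t' k i m ∧ ρ.state (t' + 1) i = (handle P i k (ρ.state t' i) m).1 := by
  obtain ⟨t', ht'⟩ := exec.arrival t k hk i hi m h
  have hs := exec.step t'
  refine ⟨t', ?_⟩
  simp only [Sent, Trace.state]
  generalize ρ.config t' = c at *
  generalize ρ.config (t' + 1) = c' at *
  rw [ht'] at hs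
  cases hs with
  | receive i k m hi auth => exact ⟨auth hk, by simp [Config.next]⟩

/-- If the goal never held, the action would stay enabled from some time on, hence be performed, and
this achieves the goal. The disjunction in `h₁` allows for the action being disabled because the
goal is already met. -/
theorem exists_of_fairness (exec : ρ.IsExecution P H) (hi : i ∈ H) (a : Action N)
    {goal : ℕ → Prop}
    (h₁ : ∀ᶠ t in atTop, goal t ∨ ∃ s o, ActionStep P i a (ρ.state t i) s o)
    (h₂ : ∀ᶠ t in atTop, ∀ o, ActionStep P i a (ρ.state t i) (ρ.state (t + 1) i) o →
      goal (t + 1)) : ∃ t, goal t := by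
  by_contra! hg
  obtain ⟨t₀, ht₀⟩ := eventually_atTop.1 (h₁.and h₂)
  obtain ⟨t, ht, hev⟩ := exec.fairness i hi a t₀ fun t ht => (ht₀ t ht).1.resolve_left (hg t)
  have hs := exec.step t
  have h := (ht₀ t ht).2
  have hn := hg (t + 1)
  simp only [Trace.state] at h
  generalize ρ.config t = c at *
  generalize ρ.config (t + 1) = c' at *
  rw [hev] at hs
  cases hs with
  | act i a s o hi hact => exact hn (h o (by simpa [Config.next] using hact))

theorem sent_ready_broadcast (exec : ρ.IsExecution P H)
    (h : ρ.Sent t i q (.ready x r)) (q' : Fin N) : ρ.Sent t i q' (.ready x r) := by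
  induction t with
  | zero => exact (exec.sent_zero h).elim
  | succ t ih =>
    obtain ⟨o, hl, ho⟩ := exec.localStep i t
    exact (ho _ _).2 (((ho _ _).1 h).imp ih fun h => hl.ready_broadcast h q')

/-- Only the first message of a sender counts, so it must be shown that an earlier one agrees: here
because a correct proposer has one root. The lemmas below use the same pattern: `gotChunk` is tied
to the permanent `myChunk`, `ready` to the unique agreed root, and `returnChunk` again to `myChunk`.
-/
theorem eventually_myChunk (exec : ρ.IsExecution P H) (hx : x.2 ∈ H) (hi : i ∈ H)
    (h : ρ.Sent t x.2 i (.chunk x r c π)) (hv : P.Verify r i c π) :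
    ∃ t, ∃ c' π', (ρ.state t i).myChunk x = some (r, c', π') := by
  obtain ⟨t', hs, ht'⟩ := exec.exists_receive hx hi h
  have hne : (ρ.state (t' + 1) i).myChunk x ≠ none := by
    rw [ht', handle]
    split_ifs with hc
    · simp
    · exact fun hn => hc ⟨rfl, hn, hv⟩
  obtain ⟨⟨r', c', π'⟩, hm⟩ := Option.ne_none_iff_exists'.1 hne
  obtain ⟨-, -, B, hB, rfl⟩ := exec.sent_chunk (exec.sent_succ hs)
  obtain ⟨-, -, B', hB', rfl⟩ := exec.sent_chunk ((exec.of_myChunk hm).2.1 hx)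
  obtain rfl := Option.some.inj (hB.symm.trans hB')
  exact ⟨t' + 1, c', π', hm⟩

theorem eventually_gotFrom (exec : ρ.IsExecution P H) (hk : k ∈ H) (hi : i ∈ H)
    (h : ρ.Sent t k i (.gotChunk x r)) : ∀ᶠ t in atTop, (ρ.state t i).gotFrom x k = some r := by
  refine eventually_of_persistent (fun t t' htt => (exec.extends i htt).gotFrom x k r) ?_
  obtain ⟨t', hs, ht'⟩ := exec.exists_receive hk hi h
  have hne : (ρ.state (t' + 1) i).gotFrom x k ≠ none := by
    rw [ht', handle]
    split_ifs with hc
    · simp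
    · exact hc
  obtain ⟨r', hm⟩ := Option.ne_none_iff_exists'.1 hne
  obtain ⟨c, π, h1⟩ := exec.sent_gotChunk (exec.sent_succ hs)
  obtain ⟨c', π', h2⟩ := exec.sent_gotChunk (exec.sent_of_gotFrom hk hm)
  exact ⟨t' + 1, by simp_all⟩

theorem eventually_readyFrom (exec : ρ.IsExecution P H) (hN : 3 * f + 1 ≤ N)
    (hH : Hᶜ.card ≤ f) (hk : k ∈ H) (hi : i ∈ H) (h : ρ.Sent t k i (.ready x r)) :
    ∀ᶠ t in atTop, (ρ.state t i).readyFrom x k = some r := by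
  refine eventually_of_persistent (fun t t' htt => (exec.extends i htt).readyFrom x k r) ?_
  obtain ⟨t', hs, ht'⟩ := exec.exists_receive hk hi h
  have hne : (ρ.state (t' + 1) i).readyFrom x k ≠ none := by
    rw [ht', handle]
    split_ifs with hc
    · simp
    · exact hc
  obtain ⟨r', hm⟩ := Option.ne_none_iff_exists'.1 hne
  rw [exec.agreed_unique hN hH (exec.agreed_of_sent_ready hH hk hs)
    (exec.agreed_of_sent_ready hH hk (exec.sent_of_readyFrom hk hm))]
  exact ⟨t' + 1, hm⟩

theorem eventually_asked (exec : ρ.IsExecution P H) (hk : k ∈ H) (hi : i ∈ H)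
    (h : ρ.Sent t k i (.requestChunk x)) : ∀ᶠ t in atTop, k ∈ (ρ.state t i).asked x := by
  refine eventually_of_persistent (fun t t' htt h => (exec.extends i htt).asked x h) ?_
  obtain ⟨t', hs, ht'⟩ := exec.exists_receive hk hi h
  exact ⟨t' + 1, by rw [ht']; simp [handle]⟩

theorem eventually_gathered (exec : ρ.IsExecution P H) (hk : k ∈ H) (hi : i ∈ H)
    (h : ρ.Sent t k i (.returnChunk x r c π)) :
    ∀ᶠ t in atTop, (ρ.state t i).gathered x k = some (r, c, π) := by
  refine eventually_of_persistent (fun t t' htt => (exec.extends i htt).gathered x k _) ?_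
  obtain ⟨t', hs, ht'⟩ := exec.exists_receive hk hi h
  obtain ⟨hasked, hm, -⟩ := exec.sent_returnChunk hs
  -- A correct server answers only clients that asked, and asking marks the instance as requested,
  -- so the client does not discard the chunk.
  have hr := exec.sent_requestChunk (exec.sent_of_asked hi hasked)
  have hne : (ρ.state (t' + 1) i).gathered x k ≠ none := by
    rw [ht', handle]
    split_ifs with hc
    · simp
    · exact fun hn => hc ⟨hr, hn, (exec.of_myChunk hm).1⟩
  obtain ⟨⟨r', c', π'⟩, hg⟩ := Option.ne_none_iff_exists'.1 hne
  have h1 := (exec.sent_returnChunk (exec.sent_succ hs)).2.1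
  have h2 := (exec.sent_returnChunk ((exec.of_gathered hg).2 hk)).2.1
  exact ⟨t' + 1, by rw [hg, ← h1, ← h2]⟩

/-! ### Completion of dispersals -/

theorem eventually_complete_of_ready (exec : ρ.IsExecution P H) (hN : 3 * f + 1 ≤ N)
    (hH : Hᶜ.card ≤ f) (h : ∀ k ∈ H, ∃ t, ∀ q, ρ.Sent t k q (.ready x r)) (hi : i ∈ H) :
    ∀ᶠ t in atTop, (ρ.state t i).Complete x := by
  have : ∀ᶠ t in atTop, ∀ k ∈ H, (ρ.state t i).readyFrom x k = some r := by
    rw [Filter.eventually_all_finset]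
    intro k hk
    obtain ⟨t, ht⟩ := h k hk
    exact exec.eventually_readyFrom hN hH hk hi (ht i)
  filter_upwards [this] with t ht
  have := (sub_le_card hH).trans (card_le_rootCount ht)
  exact exec.complete_of_readyFrom (r := r) (by omega)

/-- Of the `2f + 1` `ready` messages seen by one node at least `f + 1` are from correct nodes.
Having been broadcast, they reach every correct node and make it send `ready` too. -/
theorem eventually_complete (exec : ρ.IsExecution P H) (hN : 3 * f + 1 ≤ N)
    (hH : Hᶜ.card ≤ f) (h : ∃ k ∈ H, ∃ t, (ρ.state t k).Complete x) (hi : i ∈ H) :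
    ∀ᶠ t in atTop, (ρ.state t i).Complete x := by
  obtain ⟨k, hk, t, h⟩ := h
  obtain ⟨r, hr⟩ := Option.ne_none_iff_exists'.1 h
  obtain ⟨D, hD, hc, h⟩ := exists_correct_subset hH (exec.readyFrom_of_chunkRoot hr)
  refine exec.eventually_complete_of_ready (r := r) hN hH (fun j hj => ?_) hi
  have : ∀ᶠ t in atTop, ∀ m ∈ D, (ρ.state t j).readyFrom x m = some r := by
    rw [Filter.eventually_all_finset]
    exact fun m hm => exec.eventually_readyFrom hN hH (hD hm) hj
      (exec.sent_ready_broadcast (exec.sent_of_readyFrom (hD hm) (h m hm)) j)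
  obtain ⟨t', ht'⟩ := this.exists
  have := card_le_rootCount ht'
  exact ⟨t', exec.sent_ready_of_readyFrom (by omega)⟩

theorem eventually_complete_of_correct (exec : ρ.IsExecution P H) (hN : 3 * f + 1 ≤ N)
    (hH : Hᶜ.card ≤ f) (hx : x.2 ∈ H) (h1 : 1 ≤ x.1) (h : ∃ t, x.1 ≤ (ρ.state t x.2).epoch)
    (hi : i ∈ H) : ∀ᶠ t in atTop, (ρ.state t i).Complete x := by
  obtain ⟨t, h⟩ := h
  obtain ⟨T, V, -, -, hs⟩ := exec.proposed h1 h
  set B := P.pack (T, V)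
  have hv : ∀ q, P.Verify (P.root B) q (P.code.encode B q) (P.proof B q) := fun q =>
    ⟨length_merkleProof _ _ _ _, pathRoot_merkleProof _ _ _ _ _
      (q.2.trans_le (Nat.le_pow_clog one_lt_two N)) (by simp [Protocol.leaves])⟩
  refine exec.eventually_complete_of_ready (r := P.root B) hN hH (fun j hj => ?_) hi
  have : ∀ᶠ t in atTop, ∀ k ∈ H, (ρ.state t j).gotFrom x k = some (P.root B) := by
    rw [Filter.eventually_all_finset]
    intro k hk
    obtain ⟨t', c', π', hm⟩ := exec.eventually_myChunk hx hk (hs k) (hv k)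
    exact exec.eventually_gotFrom hk hj ((exec.of_myChunk hm).2.2 j)
  obtain ⟨t', ht'⟩ := this.exists
  exact ⟨t', exec.sent_ready_of_gotFrom (by omega)
    ((sub_le_card hH).trans (card_le_rootCount ht'))⟩

/-! ### Progress of the epochs -/

theorem eventually_epoch (exec : ρ.IsExecution P H) {e : ℕ} (h : ∃ t, e ≤ (ρ.state t i).epoch) :
    ∀ᶠ t in atTop, e ≤ (ρ.state t i).epoch :=
  eventually_of_persistent (fun _ _ htt h => h.trans (exec.extends i htt).epoch) h

theorem exists_baIn_of_complete (exec : ρ.IsExecution P H) (hi : i ∈ H) (h1 : 1 ≤ x.1)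
    (he : ∃ t, x.1 ≤ (ρ.state t i).epoch) (hc : ∀ᶠ t in atTop, (ρ.state t i).Complete x) :
    ∃ t, (ρ.state t i).baIn x ≠ none := by
  refine exec.exists_of_fairness hi (.inputOne x) ?_ (.of_forall fun t o h => ?_)
  · filter_upwards [hc, exec.eventually_epoch he] with t hc he
    by_cases h : (ρ.state t i).baIn x = none
    · exact .inr ⟨_, _, .inputOne _ x ⟨h1, he⟩ hc h⟩
    · exact .inl h
  · generalize ρ.state (t + 1) i = s at *
    cases h
    simp

theorem exists_baIn_of_card (exec : ρ.IsExecution P H) (hi : i ∈ H) {e : ℕ} (h1 : 1 ≤ e)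
    (he : ∃ t, e ≤ (ρ.state t i).epoch)
    (hc : ∀ᶠ t in atTop, N - f ≤ ((ρ.state t i).committed e).card) (j : Fin N) :
    ∃ t, (ρ.state t i).baIn (e, j) ≠ none := by
  refine exec.exists_of_fairness hi (.inputZero e) ?_ (.of_forall fun t o h => ?_)
  · filter_upwards [hc, exec.eventually_epoch he] with t hc he
    by_cases h : (ρ.state t i).baIn (e, j) = none
    · exact .inr ⟨_, _, .inputZero _ e ⟨h1, he⟩ hc ⟨j, h⟩⟩
    · exact .inl h
  · generalize ρ.state (t + 1) i = s at *
    cases h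
    dsimp only
    split_ifs with h
    · simp
    · simpa using h

/-- If no correct node ever saw `N - f` outputs 1, none would ever input 0. By termination and
validity all instances of correct proposers would then output 1, and there are at least `N - f` of
those. -/
theorem exists_card_committed (exec : ρ.IsExecution P H) (ba : ∀ x, ρ.IsBinaryAgreement H x)
    (hN : 3 * f + 1 ≤ N) (hH : Hᶜ.card ≤ f) (hi : i ∈ H) {e : ℕ} (h1 : 1 ≤ e)
    (he : ∀ i ∈ H, ∃ t, e ≤ (ρ.state t i).epoch) :
    ∃ i ∈ H, ∃ t, N - f ≤ ((ρ.state t i).committed e).card := by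
  by_contra! hcon
  have : ∀ᶠ t in atTop, ∀ j ∈ H, (ρ.state t i).baOut (e, j) = some true := by
    rw [Filter.eventually_all_finset]
    intro j hj
    refine eventually_of_persistent (fun t t' htt => (exec.extends i htt).baOut (e, j) true) ?_
    obtain ⟨t, ht⟩ := (ba (e, j)).termination (fun k hk =>
      exec.exists_baIn_of_complete hk h1 (he k hk)
        (exec.eventually_complete_of_correct hN hH hj h1 (he j hj) hk)) i hi
    obtain ⟨b, hb⟩ := Option.ne_none_iff_exists'.1 ht
    cases b
    · obtain ⟨k, hk, hin⟩ := (ba (e, j)).validity _ _ i hi hb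
      exact absurd (exec.card_committed_of_baIn hin) (hcon k hk t).not_ge
    · exact ⟨t, hb⟩
  obtain ⟨t, ht⟩ := this.exists
  refine absurd ((sub_le_card hH).trans (Finset.card_le_card fun j hj => ?_))
    (hcon i hi t).not_ge
  simp [NodeState.committed, ht j hj]

/-- Agreement spreads the `N - f` outputs 1 to all correct nodes; each of them then gives its
missing inputs, so termination applies to every instance. -/
theorem exists_baOut (exec : ρ.IsExecution P H) (ba : ∀ x, ρ.IsBinaryAgreement H x)
    (hN : 3 * f + 1 ≤ N) (hH : Hᶜ.card ≤ f) (hi : i ∈ H) {e : ℕ} (h1 : 1 ≤ e)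
    (he : ∀ i ∈ H, ∃ t, e ≤ (ρ.state t i).epoch) (j : Fin N) :
    ∃ t, (ρ.state t i).baOut (e, j) ≠ none := by
  refine (ba (e, j)).termination (fun k hk => exec.exists_baIn_of_card hk h1 (he k hk) ?_ j) i hi
  obtain ⟨m, hm, t, hc⟩ := exec.exists_card_committed ba hN hH hi h1 he
  have : ∀ᶠ u in atTop, ∀ l ∈ (ρ.state t m).committed e,
      (ρ.state u k).baOut (e, l) = some true := by
    rw [Filter.eventually_all_finset]
    intro l hl
    refine eventually_of_persistent (fun t t' htt => (exec.extends k htt).baOut (e, l) true) ?_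
    exact (ba (e, l)).agreement true m hm ⟨t, by simpa [NodeState.committed] using hl⟩ k hk
  filter_upwards [this] with u hu
  refine hc.trans (Finset.card_le_card fun l hl => ?_)
  simp [NodeState.committed, hu l hl]

theorem eventually_decided_of_epoch (exec : ρ.IsExecution P H)
    (ba : ∀ x, ρ.IsBinaryAgreement H x) (hN : 3 * f + 1 ≤ N) (hH : Hᶜ.card ≤ f) (hi : i ∈ H)
    {e : ℕ} (h1 : 1 ≤ e) (he : ∀ i ∈ H, ∃ t, e ≤ (ρ.state t i).epoch) :
    ∀ᶠ t in atTop, (ρ.state t i).Decided e := by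
  have : ∀ᶠ t in atTop, ∀ j, (ρ.state t i).baOut (e, j) ≠ none := by
    rw [Filter.eventually_all]
    intro j
    refine eventually_of_persistent (fun t t' htt h => ?_) (exec.exists_baOut ba hN hH hi h1 he j)
    rwa [(exec.extends i htt).baOut_eq_of_ne_none h]
  filter_upwards [this, exec.eventually_epoch (he i hi)] with t h2 h3 using ⟨h1, h3, h2⟩

theorem exists_isGreatest_complete (exec : ρ.IsExecution P H) (i j : Fin N) (t : ℕ) :
    ∃ n, IsGreatest {n : ℕ | ∀ d, 1 ≤ d → d ≤ n → (ρ.state t i).Complete (d, j)} n := by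
  have hb : BddAbove {n : ℕ | ∀ d, 1 ≤ d → d ≤ n → (ρ.state t i).Complete (d, j)} := by
    obtain ⟨b, hb⟩ := ((exec.finite_complete i t).image Prod.fst).bddAbove
    refine ⟨b, fun n hn => ?_⟩
    rcases n.eq_zero_or_pos with rfl | h0
    · exact Nat.zero_le b
    · exact hb ⟨(n, j), hn n h0 le_rfl, rfl⟩
  exact ⟨_, Nat.sSup_mem ⟨0, fun d h1 h2 => by omega⟩ hb, fun n hn => le_csSup hb hn⟩

theorem exists_epoch [Nonempty Tx] (exec : ρ.IsExecution P H)
    (ba : ∀ x, ρ.IsBinaryAgreement H x) (hN : 3 * f + 1 ≤ N) (hH : Hᶜ.card ≤ f) (e : ℕ) :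
    ∀ i ∈ H, ∃ t, e ≤ (ρ.state t i).epoch := by
  induction e with
  | zero => exact fun i hi => ⟨0, Nat.zero_le _⟩
  | succ e ih =>
    intro i hi
    refine exec.exists_of_fairness hi .startEpoch (goal := fun t => e + 1 ≤ (ρ.state t i).epoch)
      ?_ ?_
    · have : ∀ᶠ t in atTop, e = 0 ∨ (ρ.state t i).Decided e := by
        rcases e.eq_zero_or_pos with h | h
        · exact .of_forall fun _ => .inl h
        · exact (exec.eventually_decided_of_epoch ba hN hH hi h ih).mono fun _ => .inr
      filter_upwards [this, exec.eventually_epoch (ih i hi)] with t h1 h2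
      rcases h2.eq_or_lt with h2 | h2
      · choose V hV using fun j => exec.exists_isGreatest_complete i j t
        -- Without a possible content for the block, `startEpoch` would never be enabled.
        obtain ⟨T⟩ := ‹Nonempty Tx›
        exact .inr ⟨_, _, .startEpoch _ T V (h2 ▸ h1) hV⟩
      · exact .inl h2
    · filter_upwards [exec.eventually_epoch (ih i hi)] with t ht o h
      generalize ρ.state (t + 1) i = s at *
      cases h
      exact Nat.succ_le_succ ht

theorem eventually_decided [Nonempty Tx] (exec : ρ.IsExecution P H)
    (ba : ∀ x, ρ.IsBinaryAgreement H x) (hN : 3 * f + 1 ≤ N) (hH : Hᶜ.card ≤ f) (hi : i ∈ H)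
    {e : ℕ} (h1 : 1 ≤ e) : ∀ᶠ t in atTop, (ρ.state t i).Decided e :=
  exec.eventually_decided_of_epoch ba hN hH hi h1 (exec.exists_epoch ba hN hH e)

end IsExecution

end Trace

end Executions

/-! ### Liveness: retrieval and delivery -/

section Executions

variable {N f : ℕ} {Tx Raw Chunk Digest : Type*}
variable {P : Protocol N f Tx Raw Chunk Digest} {H : Finset (Fin N)}
  {ρ : Trace N Raw Chunk Digest} {i j k : Fin N} {t t' : ℕ} {x : Inst N} {q : Fin N}
  {r r' : Digest} {c : Chunk} {π : List Digest}

open Filter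

namespace Trace

namespace IsExecution

/-! ### Progress of retrieval -/

theorem eventually_requested (exec : ρ.IsExecution P H) (hi : i ∈ H)
    (hw : ∀ᶠ t in atTop, (ρ.state t i).Wanted P x) :
    ∀ᶠ t in atTop, x ∈ (ρ.state t i).requested := by
  refine eventually_of_persistent (fun t t' htt h => (exec.extends i htt).requested h) ?_
  refine exec.exists_of_fairness hi (.request x) ?_ (.of_forall fun t o h => ?_)
  · filter_upwards [hw] with t hw
    by_cases h : x ∈ (ρ.state t i).requested
    · exact .inl h
    · exact .inr ⟨_, _, .request _ x h hw⟩
  · generalize ρ.state (t + 1) i = s at *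
    cases h
    simp

theorem exists_sent_returnChunk (exec : ρ.IsExecution P H) (hN : 3 * f + 1 ≤ N)
    (hH : Hᶜ.card ≤ f) (hk : k ∈ H)
    (ha : ∀ᶠ t in atTop, i ∈ (ρ.state t k).asked x)
    (hc : ∀ᶠ t in atTop, (ρ.state t k).Complete x) (hr : ρ.Agreed f H x r)
    (hm : ∀ᶠ t in atTop, (ρ.state t k).myChunk x = some (r, c, π)) :
    ∃ t, ρ.Sent t k i (.returnChunk x r c π) := by
  obtain ⟨t, ht⟩ : ∃ t, i ∈ (ρ.state t k).answered x := by
    refine exec.exists_of_fairness hk (.answer x i) ?_ (.of_forall fun t o h => ?_)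
    · filter_upwards [ha, hc, hm] with t ha hc hm
      obtain ⟨r', hr'⟩ := Option.ne_none_iff_exists'.1 hc
      -- The root at which the server completed is agreed as well, so it is the root of the stored
      -- chunk and the server may answer.
      obtain rfl : r = r' := exec.agreed_unique hN hH hr (exec.agreed_of_readyFrom hH
        ((show f + 1 ≤ 2 * f + 1 by omega).trans (exec.readyFrom_of_chunkRoot hr')))
      by_cases h : i ∈ (ρ.state t k).answered x
      · exact .inl h
      · exact .inr ⟨_, _, .answer _ x i r c π ⟨ha, h⟩ hr' hm⟩
    · generalize ρ.state (t + 1) k = s at *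
      cases h
      simp
  obtain ⟨r', c', π', h1, h2⟩ := exec.sent_of_answered ht
  obtain ⟨t', hm, htt⟩ := (hm.and (eventually_ge_atTop t)).exists
  have := (exec.extends k htt).myChunk _ _ h1
  exact ⟨t, by simp_all⟩

/-- The `N - 2f` correct holders of chunks under the agreed root all complete the instance, receive
the request and answer; their chunks alone enable decoding. The node may decode other chunks
instead, which serves equally well here. -/
theorem eventually_retrieved (exec : ρ.IsExecution P H) (hN : 3 * f + 1 ≤ N)
    (hH : Hᶜ.card ≤ f) (hi : i ∈ H) (hw : ∀ᶠ t in atTop, (ρ.state t i).Wanted P x)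
    (hc : ∃ k ∈ H, ∃ t, (ρ.state t k).Complete x) :
    ∀ᶠ t in atTop, (ρ.state t i).retrieved x ≠ none := by
  have hreq := exec.eventually_requested hi hw
  obtain ⟨r, hr⟩ : ∃ r, ρ.Agreed f H x r := by
    obtain ⟨k, hk, t, hc⟩ := hc
    obtain ⟨r, hr⟩ := Option.ne_none_iff_exists'.1 hc
    exact ⟨r, exec.agreed_of_readyFrom hH
      ((show f + 1 ≤ 2 * f + 1 by omega).trans (exec.readyFrom_of_chunkRoot hr))⟩
  obtain ⟨t₀, D, hD, hcard, hmine⟩ := exec.exists_myChunk_of_agreed hH hr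
  have hgath : ∀ᶠ t in atTop, ∀ k ∈ D, ∃ c π, (ρ.state t i).gathered x k = some (r, c, π) := by
    rw [Filter.eventually_all_finset]
    intro k hk
    obtain ⟨c, π, hm⟩ := hmine k hk
    have hm' := eventually_of_persistent
      (fun t t' htt => (exec.extends k htt).myChunk x (r, c, π)) ⟨t₀, hm⟩
    obtain ⟨t₁, ht₁⟩ := hreq.exists
    obtain ⟨t, ht⟩ := exec.exists_sent_returnChunk hN hH (hD hk)
      (exec.eventually_asked hi (hD hk) (exec.sent_of_requested ht₁ k))
      (exec.eventually_complete hN hH hc (hD hk)) hr hm'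
    exact (exec.eventually_gathered (hD hk) hi ht).mono fun _ h => ⟨c, π, h⟩
  refine eventually_of_persistent
    (fun t t' htt h => by rwa [(exec.extends i htt).retrieved_eq_of_ne_none h]) ?_
  refine exec.exists_of_fairness hi (.decode x) ?_ (.of_forall fun t o h => ?_)
  · filter_upwards [hreq, hgath] with t hreq hgath
    by_cases h : (ρ.state t i).retrieved x = none
    · choose c π hg using hgath
      exact .inr ⟨_, _, .decode _ x r D (fun k => if h : k ∈ D then some (c k h) else none) _
        ⟨hreq, h⟩ hcard (fun k hk => ⟨c k hk, π k hk, hg k hk, dif_pos hk⟩)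
        (fun k hk => dif_neg hk) rfl⟩
    · exact .inl h
  · generalize ρ.state (t + 1) i = s at *
    cases h
    simp

theorem eventually_downloaded [Nonempty Tx] (exec : ρ.IsExecution P H)
    (ba : ∀ x, ρ.IsBinaryAgreement H x) (hN : 3 * f + 1 ≤ N) (hH : Hᶜ.card ≤ f) (hi : i ∈ H)
    {e : ℕ} (h1 : 1 ≤ e) : ∀ᶠ t in atTop, (ρ.state t i).Downloaded e := by
  have hdec := exec.eventually_decided ba hN hH hi h1
  obtain ⟨t₀, h₀⟩ := eventually_atTop.1 hdec
  have : ∀ᶠ t in atTop, ∀ j ∈ (ρ.state t₀ i).committed e,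
      (ρ.state t i).retrieved (e, j) ≠ none := by
    rw [Filter.eventually_all_finset]
    intro j hj
    refine exec.eventually_retrieved hN hH hi ?_ ?_
    · filter_upwards [eventually_ge_atTop t₀] with t ht
      refine .inl ⟨h₀ t ht, ?_⟩
      rwa [(exec.extends i ht).committed_eq (h₀ t₀ le_rfl)]
    -- An output 1 means that a correct node gave input 1, which it does only for a complete
    -- dispersal.
    · obtain ⟨k, hk, hin⟩ := (ba (e, j)).validity true t₀ i hi
        (by simpa [NodeState.committed] using hj)
      exact ⟨k, hk, t₀, exec.complete_of_baIn hin⟩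
  filter_upwards [this, eventually_ge_atTop t₀] with t h ht
  refine ⟨h₀ t ht, ?_⟩
  rwa [(exec.extends i ht).committed_eq (h₀ t₀ le_rfl)]

/-- `deliverLinked` needs a list of the linked blocks, so an infinite estimate would block delivery
forever. -/
theorem finite_linked (exec : ρ.IsExecution P H) (coll : ρ.CollisionFree P H)
    (ba : ∀ x, ρ.IsBinaryAgreement H x) (hN : 3 * f + 1 ≤ N) (hH : Hᶜ.card ≤ f)
    (hi : i ∈ H) {e : ℕ} (h : (ρ.state t i).Downloaded e) :
    {x | (ρ.state t i).Linked P e x}.Finite := by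
  choose n hn _ using exec.complete_of_estimate coll ba hN hH hi h
  refine ((Set.finite_Iic (Finset.univ.sup n)).prod Set.finite_univ).subset fun x hx => ?_
  exact ⟨(Nat.cast_le.1 (hx.2.trans (hn x.2))).trans (Finset.le_sup (Finset.mem_univ x.2)), trivial⟩

theorem eventually_retrieved_linked [Nonempty Tx] (exec : ρ.IsExecution P H)
    (coll : ρ.CollisionFree P H) (ba : ∀ x, ρ.IsBinaryAgreement H x) (hN : 3 * f + 1 ≤ N)
    (hH : Hᶜ.card ≤ f) (hi : i ∈ H) {e : ℕ} (h1 : 1 ≤ e) :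
    ∀ᶠ t in atTop, {x | (ρ.state t i).Linked P e x}.Finite ∧
      ∀ x, (ρ.state t i).Linked P e x → (ρ.state t i).retrieved x ≠ none := by
  obtain ⟨t₀, h₀⟩ := eventually_atTop.1 (exec.eventually_downloaded ba hN hH hi h1)
  -- Once the committed blocks are downloaded the estimate is frozen, so finitely many retrievals,
  -- fixed at time `t₀`, have to be awaited.
  have heq : ∀ t ≥ t₀, ∀ x, (ρ.state t i).Linked P e x ↔ (ρ.state t₀ i).Linked P e x := by
    intro t ht x
    rw [NodeState.Linked, NodeState.Linked,
      exec.estimate_unique coll ba hN hH hi hi (h₀ t ht) (h₀ t₀ le_rfl)]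
  have hfin := exec.finite_linked coll ba hN hH hi (h₀ t₀ le_rfl)
  have : ∀ᶠ t in atTop, ∀ x ∈ {x | (ρ.state t₀ i).Linked P e x},
      (ρ.state t i).retrieved x ≠ none := by
    rw [Filter.eventually_all_finite hfin]
    intro x hx
    refine exec.eventually_retrieved hN hH hi ?_ ?_
    · filter_upwards [eventually_ge_atTop t₀] with t ht
      exact .inr ⟨e, h₀ t ht, (heq t ht x).2 hx⟩
    · obtain ⟨n, hn, k, hk, t', h⟩ := exec.complete_of_estimate coll ba hN hH hi (h₀ t₀ le_rfl) x.2
      exact ⟨k, hk, t', h x.1 hx.1 (Nat.cast_le.1 (hx.2.trans hn))⟩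
  filter_upwards [this, eventually_ge_atTop t₀] with t h ht
  exact ⟨by simpa only [heq t ht] using hfin, fun x hx => h x ((heq t ht x).1 hx)⟩

/-! ### Progress of delivery -/

theorem exists_deliverCommitted {s : NodeState N Raw Chunk Digest} (stage : s.linking = false)
    (downloaded : s.Downloaded (s.finished + 1)) :
    ∃ s' o, ActionStep P i .deliverCommitted s s' o := by
  classical
  let F := (s.committed (s.finished + 1)).filter fun j =>
    P.skipDelivered = true → (s.finished + 1, j) ∉ s.delivered
  exact ⟨_, _, .deliverCommitted s (F.sort (· ≤ ·)) stage downloaded (Finset.sortedLT_sort F).pairwise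
    fun j => by simp [F]⟩

theorem exists_deliverLinked {s : NodeState N Raw Chunk Digest} (stage : s.linking = true)
    (fin : {x | s.Linked P (s.finished + 1) x}.Finite)
    (downloaded : ∀ x, s.Linked P (s.finished + 1) x → s.retrieved x ≠ none) :
    ∃ s' o, ActionStep P i .deliverLinked s s' o := by
  classical
  -- Moving to `Lex` makes the sort use the lexicographic order, first by epoch and then by node,
  -- instead of the componentwise order.
  let F := (fin.toFinset.filter (· ∉ s.delivered)).map toLex.toEmbedding
  have hF : ∀ x, x ∈ (F.sort (· ≤ ·)).map ofLex ↔
      s.Linked P (s.finished + 1) x ∧ x ∉ s.delivered := by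
    intro x
    simp [F]
  refine ⟨_, _, .deliverLinked s ((F.sort (· ≤ ·)).map ofLex) stage ?_ hF
    fun x hx => downloaded x ((hF x).1 hx).1⟩
  rw [List.pairwise_map]
  exact (Finset.sortedLT_sort F).pairwise

theorem exists_le_stage [Nonempty Tx] (exec : ρ.IsExecution P H) (coll : ρ.CollisionFree P H)
    (ba : ∀ x, ρ.IsBinaryAgreement H x) (hN : 3 * f + 1 ≤ N) (hH : Hᶜ.card ≤ f)
    (hi : i ∈ H) (n : ℕ) : ∃ t, n ≤ (ρ.state t i).stage := by
  induction n with
  | zero => exact ⟨0, Nat.zero_le _⟩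
  | succ n ih =>
    have hge := eventually_of_persistent
      (fun t t' htt h => h.trans (exec.extends i htt).stage) ih
    -- At stage `n` exactly `n / 2` epochs are finished, so the next delivery belongs to epoch `n /
    -- 2 + 1`; the parity of `n` tells which of the two deliveries it is.
    have h1 : 1 ≤ n / 2 + 1 := by omega
    rcases Nat.mod_two_eq_zero_or_one n with hn | hn
    · refine exec.exists_of_fairness hi .deliverCommitted
        (goal := fun t => n + 1 ≤ (ρ.state t i).stage) ?_ ?_
      · filter_upwards [hge, exec.eventually_downloaded ba hN hH hi h1] with t ht hd
        rcases ht.eq_or_lt with ht | ht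
        · right
          cases hl : (ρ.state t i).linking
          · obtain hf : (ρ.state t i).finished = n / 2 := by simp [NodeState.stage, hl] at ht; omega
            exact exists_deliverCommitted hl (hf ▸ hd)
          · simp [NodeState.stage, hl] at ht
            omega
        · exact .inl ht
      · filter_upwards [hge] with t ht o h
        generalize ρ.state (t + 1) i = s at *
        cases h
        simp_all [NodeState.stage]
    · refine exec.exists_of_fairness hi .deliverLinked
        (goal := fun t => n + 1 ≤ (ρ.state t i).stage) ?_ ?_
      · filter_upwards [hge, exec.eventually_retrieved_linked coll ba hN hH hi h1] with t ht hd
        rcases ht.eq_or_lt with ht | ht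
        · right
          cases hl : (ρ.state t i).linking
          · simp [NodeState.stage, hl] at ht
            omega
          · obtain hf : (ρ.state t i).finished = n / 2 := by simp [NodeState.stage, hl] at ht; omega
            rw [← hf] at hd
            exact exists_deliverLinked hl hd.1 hd.2
        · exact .inl ht
      · filter_upwards [hge] with t ht o h
        generalize ρ.state (t + 1) i = s at *
        cases h
        simp_all [NodeState.stage]
        omega

/-- The stage starts at 0, is unbounded and rises by at most one per step, so it equals `n` at the
first time it is at least `n`. -/
theorem exists_stage_eq [Nonempty Tx] (exec : ρ.IsExecution P H) (coll : ρ.CollisionFree P H)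
    (ba : ∀ x, ρ.IsBinaryAgreement H x) (hN : 3 * f + 1 ≤ N) (hH : Hᶜ.card ≤ f)
    (hi : i ∈ H) (n : ℕ) : ∃ t, (ρ.state t i).stage = n := by
  have h := exec.exists_le_stage coll ba hN hH hi n
  classical
  refine ⟨Nat.find h, (Nat.find_spec h).antisymm' ?_⟩
  rcases ht : Nat.find h with _ | t
  · simp [exec.init_node, initialState, NodeState.stage]
  · have := Nat.find_min h (m := t) (by omega)
    obtain ⟨o, hl, -⟩ := exec.localStep i t
    have := hl.stage_le
    omega

theorem log_eq_of_stage_eq (exec : ρ.IsExecution P H) (coll : ρ.CollisionFree P H)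
    (ba : ∀ x, ρ.IsBinaryAgreement H x) (hN : 3 * f + 1 ≤ N) (hH : Hᶜ.card ≤ f)
    (hi : i ∈ H) (hj : j ∈ H) (h : (ρ.state t i).stage = (ρ.state t' j).stage) :
    (ρ.state t i).log = (ρ.state t' j).log := by
  obtain ⟨S, E, R, hlog⟩ := exec.exists_commonLog coll ba hN hH
  have h1 := hlog i hi t
  have h2 := hlog j hj t'
  have h3 : (ρ.state t i).finished = (ρ.state t' j).finished ∧
      (ρ.state t i).linking = (ρ.state t' j).linking := by
    simp only [NodeState.stage] at h
    grind
  rw [h3.1, h3.2] at h1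
  exact (h1.unique h2).1

/-- Let `i` run until it attains the stage of `j`: its log there equals that of `j`, and its own log
only grows. -/
theorem log_prefix_of_stage_le [Nonempty Tx] (exec : ρ.IsExecution P H)
    (coll : ρ.CollisionFree P H) (ba : ∀ x, ρ.IsBinaryAgreement H x) (hN : 3 * f + 1 ≤ N)
    (hH : Hᶜ.card ≤ f) (hi : i ∈ H) (hj : j ∈ H)
    (h : (ρ.state t i).stage ≤ (ρ.state t' j).stage) :
    (ρ.state t i).log <+: (ρ.state t' j).log := by
  obtain ⟨u, hu⟩ := exec.exists_stage_eq coll ba hN hH hi (ρ.state t' j).stage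
  rw [← exec.log_eq_of_stage_eq coll ba hN hH hi hj hu]
  rcases le_total t u with htu | htu
  · exact (exec.extends i htu).log
  -- If `i` was at that stage no later than `t`, monotonicity makes the two stages equal, hence the
  -- logs.
  · rw [exec.log_eq_of_stage_eq coll ba hN hH hi hi
      ((h.trans hu.ge).antisymm (exec.extends i htu).stage)]

theorem delivers_of_delivers [Nonempty Tx] (exec : ρ.IsExecution P H)
    (coll : ρ.CollisionFree P H) (ba : ∀ x, ρ.IsBinaryAgreement H x) (hN : 3 * f + 1 ≤ N)
    (hH : Hᶜ.card ≤ f) (hi : i ∈ H) (hj : j ∈ H) {n : ℕ} {b : Entry N Raw}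
    (h : ρ.Delivers i n b) : ρ.Delivers j n b := by
  obtain ⟨t, ht⟩ := h
  obtain ⟨u, hu⟩ := exec.exists_stage_eq coll ba hN hH hj (ρ.state t i).stage
  exact ⟨u, by rwa [exec.log_eq_of_stage_eq coll ba hN hH hj hi hu]⟩

theorem deliveredAfter_iff {e : ℕ} {L : List (Entry N Raw)} :
    ρ.DeliveredAfter i e t L ↔ (ρ.state t i).stage = 2 * e ∧ (ρ.state t i).log = L := by
  rw [DeliveredAfter, NodeState.stage, ← and_assoc]
  refine and_congr_left fun _ => ?_
  cases (ρ.state t i).linking <;> simp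
  omega

end IsExecution

end Trace

end Executions

end DispersedLedger

theorem mainTheorem1 {N f : ℕ} (hN : 3 * f + 1 ≤ N)
    {Tx Raw Chunk Digest : Type*} [Nonempty Tx]
    (P : Protocol N f Tx Raw Chunk Digest)
    (H : Finset (Fin N)) (hH : Hᶜ.card ≤ f)
    (ρ : Trace N Raw Chunk Digest)
    (exec : ρ.IsExecution P H)
    (ba : ∀ x, ρ.IsBinaryAgreement H x)
    (coll : ρ.CollisionFree P H)
    (i j : Fin N) (hi : i ∈ H) (hj : j ∈ H) :
    (∀ n b, ρ.Delivers i n b ↔ ρ.Delivers j n b) ∧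
    (∀ t t', (ρ.state t i).log <+: (ρ.state t' j).log ∨
      (ρ.state t' j).log <+: (ρ.state t i).log) ∧
    (∀ e, ∃ L, (∃ t, ρ.DeliveredAfter i e t L) ∧ (∃ t, ρ.DeliveredAfter j e t L) ∧
      ∀ t L', ρ.DeliveredAfter i e t L' ∨ ρ.DeliveredAfter j e t L' → L' = L) := by
  refine ⟨fun n b => ⟨exec.delivers_of_delivers coll ba hN hH hi hj,
    exec.delivers_of_delivers coll ba hN hH hj hi⟩, fun t t' => ?_, fun e => ?_⟩
  · exact (le_total (ρ.state t i).stage (ρ.state t' j).stage).imp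
      (exec.log_prefix_of_stage_le coll ba hN hH hi hj)
      (exec.log_prefix_of_stage_le coll ba hN hH hj hi)
  · obtain ⟨t, ht⟩ := exec.exists_stage_eq coll ba hN hH hi (2 * e)
    obtain ⟨t', ht'⟩ := exec.exists_stage_eq coll ba hN hH hj (2 * e)
    simp only [Trace.IsExecution.deliveredAfter_iff]
    refine ⟨(ρ.state t i).log, ⟨t, ht, rfl⟩, ⟨t', ht',
      exec.log_eq_of_stage_eq coll ba hN hH hj hi (ht'.trans ht.symm)⟩, ?_⟩
    rintro u L' (⟨hu, rfl⟩ | ⟨hu, rfl⟩)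
    · exact exec.log_eq_of_stage_eq coll ba hN hH hi hi (hu.trans ht.symm)
    · exact exec.log_eq_of_stage_eq coll ba hN hH hj hi (hu.trans ht.symm)
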